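/- **Definitions.** For a finite sequence $\sigma$ let $|\sigma|$ be its length and $\|\sigma\|$ the number of distinct symbols in it. Write $\sigma\prec S$ if some subsequence of $S$ equals $\sigma$ up to an injective renaming of symbols; otherwise $S$ is $\sigma$-free. $S$ is $r$-sparse if equal symbols at distinct positions are at distance at least $r$. Let $$\operatorname{Ex}(\sigma,n)=\max\{|S| : \sigma\nprec S,\ \|S\|=n,\ S\text{ is }\|\sigma\|\text{-sparse}\}.$$ The one-sided comb is $C_k = 1\,2\,3\cdots(k+2)\;1\,(k+2)\;2\,(k+2)\;3\,(k+2)\cdots(k+1)\,(k+2)$, so that $C_1=abcacbc$. Let $a_{1,j}=2^j$ for $j\ge1$, $a_{i,1}=2$ for $i\ge 2$, and $a_{i,j}=w\cdot a_{i-1,w}$ with $w=a_{i,j-1}$ for $i,j\ge2$. The inverse Ackermann function is $\alpha(n)=\min\{i\ge 1: a_{i,3}\ge n\}$; $\alpha^k(n)$ denotes $(\alpha(n))^k$. *Blocked sequences.* Consider sequences partitioned into blocks of distinct symbols, each block being live, written $(\cdots)$, or dead, written $\langle\cdots\rangle$. A sequence is canonical if its alphabet is $\{1,\dots,\|T\|\}$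 with symbols numbered by first appearance; all sequences below are put in canonical form. If all live blocks of $T_{\rm top}$ have length $\|T_{\rm mid}\|$, then $T_{\rm top}\circ T_{\rm mid}$ is obtained by replacing each live block $(b_1,\dots,b_l)$ of $T_{\rm top}$ by a copy of $T_{\rm mid}$ under $x\mapsto b_x$. If $T_{\rm bot}$ has $l$ live blocks and all live blocks of $T_{\rm sub}$ have length $l$, the preshuffle (respectively postshuffle) of $T_{\rm sub}$ and $T_{\rm bot}$ is obtained by replacing each live block $(b_1,\dots,b_l)$ of $T_{\rm sub}$ by a new copy of $T_{\rm bot}$ (all copies over pairwise disjoint alphabets, disjoint from that of $T_{\rm sub}$) into which $b_p$ has been inserted at the beginning (respectively end) of the $p$-th live block, for every $p$; the dead blocks of $T_{\rm sub}$ stay in place. *Class I sequences.* Let $\pi\in\{\nearrow,\searrow\}^*$ be a pattern of length $|\pi|\ge2$ starting with $\nearrow$, with last character $\chi$, and let $\pi^-$ be $\pi$ without its last character. For $i\ge1$, $j\ge0$ define $T_\pi(i,j)$ as follows. - If $|\pi|=2$ or $i=1$, then $T_\pi(i,j)=(1\,2\cdots j)\,\langle j\cdots 2\,1\rangle$ if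 $\chi=\searrow$, and $T_\pi(i,j)=(1\,2\cdots j)\,\langle 1\,2\cdots j\rangle$ if $\chi=\nearrow$. - If $|\pi|>2$ and $i>1$, then $T_\pi(i,0)$ consists of two empty live blocks. - If $|\pi|>2$, $i>1$ and $j>0$, let $T_{\rm bot}=T_\pi(i,j-1)$, let $T_{\rm mid}=T_{\pi^-}(i,l)$ where $l$ is the number of live blocks of $T_{\rm bot}$, and let $T_{\rm top}=T_\pi(i-1,\|T_{\rm mid}\|)$. Then $T_\pi(i,j)$ is the preshuffle of $T_{\rm top}\circ T_{\rm mid}$ and $T_{\rm bot}$ if $\chi=\searrow$, and their postshuffle if $\chi=\nearrow$. **Theorem.** Let $k\ge1$ and $\pi=\nearrow\nearrow\searrow^k$. Then $C_k\nprec T_\pi(i,j)$ for all $i\ge1$ and $j\ge0$. Moreover, $\operatorname{Ex}(C_k,n)=\Omega(n\,\alpha^k(n))$ as $n\to\infty$, with a constant that may depend on $k$. -/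

import Mathlib

namespace GenDS

/-! ### Sequences and forbidden patterns -/

/-- The size `‖σ‖` of the alphabet of a sequence. -/
def alphabetSize (σ : List ℕ) : ℕ := σ.toFinset.card

/-- Two sequences are isomorphic if they agree up to a renaming of their alphabets. -/
def Isomorphic (σ τ : List ℕ) : Prop :=
  ∃ f : ℕ → ℕ, Set.InjOn f {x | x ∈ σ} ∧ σ.map f = τ

/-- `σ ≺ S`: the sequence `σ` is isomorphic to a subsequence of `S`. -/
def Contains (S σ : List ℕ) : Prop :=
  ∃ τ : List ℕ, τ.Sublist S ∧ Isomorphic σ τ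

/-- `S` is `r`-sparse: equal symbols at distinct positions are at distance at least `r`. -/
def IsSparse (r : ℕ) (S : List ℕ) : Prop :=
  ∀ (p q : ℕ) (hp : p < S.length) (hq : q < S.length), p < q → S[p] = S[q] → p + r ≤ q

/-- The lengths of the `σ`-free, `‖σ‖`-sparse sequences over exactly `n` letters. -/
def freeLengths (σ : List ℕ) (n : ℕ) : Set ℕ :=
  {L | ∃ S : List ℕ, S.length = L ∧ ¬ Contains S σ ∧ alphabetSize S = n ∧
    IsSparse (alphabetSize σ) S}

/-- The extremal function `Ex(σ, n)`, the maximum of `freeLengths σ n`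
(a bounded set, see `bddAbove_freeLengths`). -/
noncomputable def Ex (σ : List ℕ) (n : ℕ) : ℕ := sSup (freeLengths σ n)

theorem bddAbove_freeLengths (σ : List ℕ) (n : ℕ) : BddAbove (freeLengths σ n) := by
  classical
  set r := alphabetSize σ with hr
  refine ⟨(n ^ r * σ.length + 1) * r, ?_⟩
  rintro L ⟨S, rfl, hfree, hn, hsp⟩
  by_contra! hlen
  apply hfree
  have hidx : ∀ (t : Fin (n ^ r * σ.length + 1)) (p : Fin r), t.1 * r + p.1 < S.length := by
    intro t p
    have h1 : (t.1 + 1) * r ≤ (n ^ r * σ.length + 1) * r := Nat.mul_le_mul_right _ t.2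
    have h2 : (t.1 + 1) * r = t.1 * r + r := by ring
    have := p.2
    omega
  let F : Fin (n ^ r * σ.length + 1) → (Fin r → S.toFinset) := fun t p =>
    ⟨S[t.1 * r + p.1]'(hidx t p), by simp⟩
  have hcard : Fintype.card (Fin r → S.toFinset) * σ.length <
      Fintype.card (Fin (n ^ r * σ.length + 1)) := by
    have : S.toFinset.card = n := hn
    rw [Fintype.card_fun, Fintype.card_coe, Fintype.card_fin, Fintype.card_fin, this]
    exact Nat.lt_succ_self _
  obtain ⟨y, hy⟩ := Fintype.exists_lt_card_fiber_of_mul_lt_card F hcard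
  let g := Finset.orderEmbOfCardLe (Finset.univ.filter fun t => F t = y) hy.le
  have hg : ∀ q, F (g q) = y := fun q => by
    have := Finset.orderEmbOfCardLe_mem (Finset.univ.filter fun t => F t = y) hy.le q
    simpa using this
  let e : σ.toFinset ≃ Fin r := σ.toFinset.equivFin
  have hyinj : ∀ (t : Fin (n ^ r * σ.length + 1)), F t = y → Function.Injective y := by
    rintro t rfl p p' hpp
    have h1 : S[t.1 * r + p.1]'(hidx t p) = S[t.1 * r + p'.1]'(hidx t p') :=
      congrArg Subtype.val hpp
    have := p.2
    have := p'.2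
    rcases lt_trichotomy p p' with h | h | h
    · have h3 : p.1 < p'.1 := h
      have := hsp _ _ (hidx t p) (hidx t p') (by omega) h1
      omega
    · exact h
    · have h3 : p'.1 < p.1 := h
      have := hsp _ _ (hidx t p') (hidx t p) (by omega) h1.symm
      omega
  let f : ℕ → ℕ := fun x => if h : x ∈ σ.toFinset then (y (e ⟨x, h⟩)).1 else 0
  refine ⟨σ.map f, ?_, f, ?_, rfl⟩
  · rw [List.sublist_iff_exists_fin_orderEmbedding_get_eq]
    have hm : ∀ q : Fin (σ.map f).length, q.1 < σ.length := fun q => by simpa using q.2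
    let u : Fin (σ.map f).length → Fin r := fun q =>
      e ⟨σ[q.1]'(hm q), List.mem_toFinset.2 (List.getElem_mem _)⟩
    refine ⟨OrderEmbedding.ofStrictMono
      (fun q => ⟨(g ⟨q.1, hm q⟩).1 * r + (u q).1, hidx _ _⟩) ?_, ?_⟩
    · intro q q' hqq
      have h1 : g ⟨q.1, hm q⟩ < g ⟨q'.1, hm q'⟩ := g.strictMono hqq
      have h2 : ((g ⟨q.1, hm q⟩).1 + 1) * r ≤ (g ⟨q'.1, hm q'⟩).1 * r :=
        Nat.mul_le_mul_right _ h1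
      have h3 : ((g ⟨q.1, hm q⟩).1 + 1) * r = (g ⟨q.1, hm q⟩).1 * r + r := by ring
      have h4 := (u q).2
      show (g ⟨q.1, hm q⟩).1 * r + (u q).1 < (g ⟨q'.1, hm q'⟩).1 * r + (u q').1
      omega
    · intro q
      have h1 := congrArg Subtype.val (congrFun (hg ⟨q.1, hm q⟩) (u q))
      have h2 : S[(g ⟨q.1, hm q⟩).1 * r + (u q).1]'(hidx _ _) = (y (u q)).1 := h1
      have h3 : (σ.map f).get q = (y (u q)).1 := by simp [f, u]
      rw [h3]
      exact h2.symm
  · intro x hx x' hx' hxx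
    have hx1 : x ∈ σ.toFinset := List.mem_toFinset.2 hx
    have hx2 : x' ∈ σ.toFinset := List.mem_toFinset.2 hx'
    have hpos : 0 < σ.length := List.length_pos_of_mem hx
    have hinj := hyinj _ (hg ⟨0, hpos⟩)
    simp only [f, hx1, hx2, dif_pos] at hxx
    have := e.injective (hinj (Subtype.ext hxx))
    exact congrArg Subtype.val this

/-- The one-sided comb `C_k = 1 2 ⋯ (k+2) 1 (k+2) 2 (k+2) 3 (k+2) ⋯ (k+1) (k+2)`. -/
def comb (k : ℕ) : List ℕ :=
  List.range' 1 (k + 2) ++ (List.range' 1 (k + 1)).flatMap fun a => [a, k + 2]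

/-! ### The inverse Ackermann function -/

/-- The array `a_{i,j}`, `i, j ≥ 1`, given by `a_{1,j} = 2^j`, `a_{i,1} = 2` for `i ≥ 2`, and
`a_{i,j} = w * a_{i-1,w}` with `w = a_{i,j-1}` for `i, j ≥ 2`.  (The values at `i = 0` or `j = 0`
are never used.) -/
def ackArray : ℕ → ℕ → ℕ
  | 0, _ => 0
  | 1, j => 2 ^ j
  | _ + 2, 0 => 0
  | _ + 2, 1 => 2
  | i + 2, j + 2 => ackArray (i + 2) (j + 1) * ackArray (i + 1) (ackArray (i + 2) (j + 1))
termination_by i j => (i, j)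

/-- `α(n, m) = min {i ≥ 1 | a_{i,j} ≥ m}` where `j = max (⌈n/m⌉, 3)`. -/
noncomputable def alpha₂ (n m : ℕ) : ℕ :=
  sInf {i : ℕ | 1 ≤ i ∧ m ≤ ackArray i (max ⌈(n : ℚ) / (m : ℚ)⌉₊ 3)}

/-- The inverse Ackermann function `α(n) = α(n, n)`. -/
noncomputable def alpha (n : ℕ) : ℕ := alpha₂ n n

theorem ackArray_pos (i j : ℕ) : 0 < ackArray (i + 1) (j + 1) := by
  induction i generalizing j with
  | zero => simp [ackArray]
  | succ i ih =>
    induction j with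
    | zero => simp [ackArray]
    | succ j ihj =>
      rw [ackArray]
      obtain ⟨w, hw⟩ := Nat.exists_eq_succ_of_ne_zero ihj.ne'
      rw [hw]
      exact Nat.mul_pos (Nat.succ_pos _) (ih w)

theorem ackArray_two (i : ℕ) : i ≤ ackArray (i + 1) 2 := by
  have h : ackArray (i + 1) 2 = 2 ^ (i + 2) := by
    induction i with
    | zero => simp [ackArray]
    | succ i ih => rw [ackArray, ackArray, ih]; ring
  rw [h]
  exact (Nat.lt_two_pow_self.trans (Nat.pow_lt_pow_right (by norm_num) (by omega))).le

theorem le_ackArray (i j : ℕ) : i ≤ ackArray (i + 1) (j + 2) := by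
  induction j with
  | zero => exact ackArray_two i
  | succ j ih =>
    refine ih.trans ?_
    cases i with
    | zero =>
      have h : ∀ t, ackArray (0 + 1) t = 2 ^ t := fun t => by rw [Nat.zero_add, ackArray]
      rw [h, h]
      exact Nat.pow_le_pow_right (by norm_num) (by omega)
    | succ i =>
      obtain ⟨w, hw⟩ := Nat.exists_eq_succ_of_ne_zero (ackArray_pos (i + 1) (j + 1)).ne'
      have h : ackArray (i + 1 + 1) (j + 1 + 2) = ackArray (i + 2) (j + 2) *
          ackArray (i + 1) (ackArray (i + 2) (j + 2)) := by rw [ackArray]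
      rw [h]
      refine Nat.le_mul_of_pos_right _ ?_
      rw [show ackArray (i + 2) (j + 2) = w + 1 from hw]
      exact ackArray_pos i w

/-- The minimum defining `α(n, m)` is taken over a nonempty set. -/
theorem alpha₂_set_nonempty (n m : ℕ) :
    {i : ℕ | 1 ≤ i ∧ m ≤ ackArray i (max ⌈(n : ℚ) / (m : ℚ)⌉₊ 3)}.Nonempty := by
  refine ⟨m + 1, by omega, ?_⟩
  obtain ⟨j, hj⟩ := Nat.exists_eq_add_of_le (show 2 ≤ max ⌈(n : ℚ) / (m : ℚ)⌉₊ 3 by omega)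
  rw [hj, Nat.add_comm 2 j]
  exact le_ackArray m j

/-! ### Blocked sequences, composition and shuffling -/

/-- A block of a sequence, designated live or dead. -/
inductive Block where
  | live (B : List ℕ)
  | dead (B : List ℕ)

namespace Block

/-- The underlying sequence of a block. -/
def symbols : Block → List ℕ
  | live B => B
  | dead B => B

/-- Rename the symbols of a block. -/
def rename (f : ℕ → ℕ) : Block → Block
  | live B => live (B.map f)
  | dead B => dead (B.map f)

/-- Is the block live? -/
def isLive : Block → Bool
  | live _ => true
  | dead _ => false

end Block

/-- A sequence partitioned into live and dead blocks. -/
abbrev BlockSeq := List Block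

namespace BlockSeq

/-- The underlying sequence of symbols. -/
def symbols (T : BlockSeq) : List ℕ := T.flatMap Block.symbols

/-- The number of live blocks. -/
def numLive (T : BlockSeq) : ℕ := T.countP Block.isLive

/-- Rename all symbols. -/
def rename (f : ℕ → ℕ) (T : BlockSeq) : BlockSeq := T.map (Block.rename f)

/-- The canonical form over the alphabet `{0, …, ‖T‖ - 1}`, symbols being ordered by first
appearance: `x` becomes the number of distinct symbols occurring before the first `x`. -/
def canonical (T : BlockSeq) : BlockSeq :=
  T.rename fun x => (T.symbols.takeWhile (· ≠ x)).toFinset.card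

/-- Composition `top ∘ mid`: every live block `B = (b_0, b_1, …)` of `top` is replaced by the copy
`mid(B)` of `mid` under the alphabet mapping `x ↦ b_x`.  It is used for `mid` in canonical form and
live blocks of length `‖mid‖`. -/
def compose (top mid : BlockSeq) : BlockSeq :=
  top.flatMap fun
    | Block.live B => mid.rename fun x => B.getD x 0
    | Block.dead B => [Block.dead B]

/-- Insert `a_1, a_2, …` into the successive live blocks of `T`, one symbol for each live block, at
the beginning of the block if `pre` is true and at its end otherwise. -/
def insertLive (pre : Bool) : List ℕ → BlockSeq → BlockSeq
  | _, [] => []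
  | as, Block.dead B :: T => Block.dead B :: insertLive pre as T
  | [], Block.live B :: T => Block.live B :: insertLive pre [] T
  | a :: as, Block.live B :: T =>
      Block.live (if pre then a :: B else B ++ [a]) :: insertLive pre as T

/-- The `q`th live block of `sub` (counting from the given number) is replaced by the `q`th copy of
`bot` with the symbols of that live block inserted in its live blocks; dead blocks of `sub` stay
where they are.  The symbols `x` of `sub` are encoded as `⟨0, x⟩` and the symbols `y` of the `q`th
copy of `bot` as `⟨q + 1, y⟩`, so that all these alphabets are disjoint. -/
def shuffleFrom (pre : Bool) (bot : BlockSeq) : ℕ → BlockSeq → BlockSeq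
  | _, [] => []
  | q, Block.dead B :: T => Block.dead (B.map (Nat.pair 0)) :: shuffleFrom pre bot q T
  | q, Block.live B :: T =>
      insertLive pre (B.map (Nat.pair 0)) (bot.rename (Nat.pair (q + 1))) ++
        shuffleFrom pre bot (q + 1) T

/-- The preshuffle (`pre = true`) or postshuffle (`pre = false`) of `sub` and `bot`, in canonical
form.  It is used when the live blocks of `sub` have length `bot.numLive`. -/
def shuffle (pre : Bool) (sub bot : BlockSeq) : BlockSeq :=
  (shuffleFrom pre bot 0 sub).canonical

end BlockSeq

/-! ### Class I sequences -/

/-- The two diagonals `↗` and `↘`. -/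
inductive Diag where
  | up
  | down
deriving DecidableEq

/-- One live block `(1 2 ⋯ j)` followed by one dead block, which is `⟨1 2 ⋯ j⟩` if the last
character of `π` is `↗` and `⟨j ⋯ 2 1⟩` if it is `↘` (symbols are numbered from `0`). -/
def twoBlocks (π : List Diag) (j : ℕ) : BlockSeq :=
  [Block.live (List.range j),
    Block.dead (if π.getLast? = some Diag.down then (List.range j).reverse else List.range j)]

/-- The Class I sequence `T_π(i, j)`, for a pattern `π` of length at least `2` that begins with `↗`,
and `i ≥ 1`, `j ≥ 0`. -/
def classI (π : List Diag) (i j : ℕ) : BlockSeq :=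
  if π.length ≤ 2 ∨ i ≤ 1 then twoBlocks π j
  else
    match j with
    | 0 => [Block.live [], Block.live []]
    | j + 1 =>
      let bot := classI π i j
      let mid := classI π.dropLast i bot.numLive
      let top := classI π (i - 1) (alphabetSize mid.symbols)
      BlockSeq.shuffle (decide (π.getLast? = some Diag.down)) (BlockSeq.compose top mid) bot
termination_by (π.length, i, j)
decreasing_by
  · exact Prod.Lex.right _ (Prod.Lex.right _ (Nat.lt_succ_self _))
  · exact Prod.Lex.left _ _ (by simp only [List.length_dropLast]; omega)
  · exact Prod.Lex.right _ (Prod.Lex.left _ _ (by omega))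

/-- The pattern `↗ ↗ ↘^k`. -/
def combPattern (k : ℕ) : List Diag :=
  Diag.up :: Diag.up :: List.replicate k Diag.down

end GenDS

/-!
Why the theorem is true. In `T_π(i, j)` with `π = ↗ ↗ ↘^k` every symbol occurs in exactly one live
block, and there for the first time (`Basic`). After a live block its symbols return in reversed
order: in a preshuffle the symbol inserted at the beginning of a live block of `bot` returns only
after the copy of `bot`, while the others return inside it (`Reversing`).

*Combs.*  Let `T` be the preshuffle of `U = top ∘ mid` and `bot`, and suppose that `T` contains
the comb `a_0 ⋯ a_k z a_0 z ⋯ a_k z`. A symbol of `U` occurs only once in each copy of `bot`. So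
if `z` comes from a copy of `bot`, the whole comb does: an `a_i` from `U` would occur in the copy,
between two `z`, for the first time, whereas it occurs before the first `z` as well. If `z` comes
from `U` and some `a_i` from `bot`, then `i = 0`, and `a_1, …, a_k, z` have been inserted in this
order into a copy of `bot`; then a live block of `U` is followed by `z a_1 z ⋯ a_k z`, which has
too many alternations, because the symbols of this block return once in monotone order in the copy
of `mid` (reversed if `k ≥ 2`, direct if `k = 1`) and once more in reversed order in `top`
(`ComposeIndex.not_teeth`). If all symbols come from `U`, either the comb survives in `top`, or a
copy of `mid` contains so much of it that `mid`, which belongs to `k - 1`, contains the smaller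
comb, which is impossible if `k ≥ 2`; for `k = 1` the order of the last two symbols gives the
contradiction (`ComposeIndex.not_mem_live`). In the first case the symbols `a_i` that enter a common copy
of `mid` may appear in the wrong order in the live block of `top`. Therefore the property carried
through the induction, `CombFree`, excludes also the combs in which `a_0, …, a_k` are permuted
within live blocks. In a shuffle this relaxation costs nothing, since a live block contains a
single symbol of `U`.

*Lengths.*  A symbol of `T_π(i + 1, j)` occurs `(i + k).choose k` times in dead blocks, by
Pascal's rule (`length_combSeq`). The recursion is started with `R` empty live blocks instead of
two (`combSeq`), which changes nothing above and makes all blocks have length at least `R` if `j =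
R`. With `R = 2 (k + 1)` at most half of the sequence is lost when each block is deprived of the
at most `k + 1` symbols that spoil `(k + 2)`-sparseness (`exists_isSparse_sublist`). The number of
symbols of `combSeq R k i R` is at most `a_{8 (k + i) + 5, 3}`, by comparison with the Ackermann
function (`numLive_combSeq_le`, `ack_le_ackArray_three`), so that `i` may be taken as large as a
constant fraction of `α(n)`. Disjoint copies of the sequence, and symbols occurring once, fill up
an alphabet of `n` symbols (`mul_le_Ex`).
-/

namespace GenDS
open BlockSeq

/-! ### Positions in blocked sequences -/

/-- `Occ T P x`: the symbol `x` occurs in the block of `T` with index `P.1`, at index `P.2` there.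
-/
def Occ (T : BlockSeq) (P : ℕ × ℕ) (x : ℕ) : Prop :=
  ∃ B, T[P.1]? = some B ∧ B.symbols[P.2]? = some x

/-- The order of positions: lexicographic, first by block, then inside the block. -/
def Before (P Q : ℕ × ℕ) : Prop := P.1 < Q.1 ∨ P.1 = Q.1 ∧ P.2 < Q.2

theorem Before.trans {P Q R : ℕ × ℕ} (h : Before P Q) (h' : Before Q R) : Before P R := by
  unfold Before at *; omega

theorem Before.irrefl {P : ℕ × ℕ} (h : Before P P) : False := by
  unfold Before at h; omega

theorem Before.ne {P Q : ℕ × ℕ} (h : Before P Q) : P ≠ Q := by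
  rintro rfl; exact h.irrefl

theorem Before.fst_le {P Q : ℕ × ℕ} (h : Before P Q) : P.1 ≤ Q.1 := by
  unfold Before at h; omega

theorem Occ.lt_length {T : BlockSeq} {P : ℕ × ℕ} {x : ℕ} (h : Occ T P x) : P.1 < T.length := by
  obtain ⟨B, hB, -⟩ := h
  exact (List.getElem?_eq_some_iff.1 hB).1

theorem Occ.mem {T : BlockSeq} {P : ℕ × ℕ} {x : ℕ} (h : Occ T P x) : x ∈ symbols T := by
  obtain ⟨B, hB, hx⟩ := h
  exact List.mem_flatMap.2 ⟨B, List.mem_of_getElem? hB, List.mem_of_getElem? hx⟩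

/-- `σ` and `β` refine the indices below `n` into pairs in a strictly increasing way. -/
def LexMono (n : ℕ) (σ β : ℕ → ℕ) : Prop :=
  ∀ b b', b < b' → b' < n → σ b < σ b' ∨ σ b = σ b' ∧ β b < β b'

theorem LexMono.le {n : ℕ} {σ β : ℕ → ℕ} (h : LexMono n σ β) {b b' : ℕ} (hb : b ≤ b')
    (hn : b' < n) : σ b ≤ σ b' := by
  rcases hb.eq_or_lt with rfl | hb
  · exact le_rfl
  · have := h b b' hb hn
    omega

/-- The entries of a flattened list are addressed by the index of a member and an index in it. -/
theorem exists_flatten_index {α : Type*} (L : List (List α)) : ∃ σ β : ℕ → ℕ,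
    (∀ b a, L.flatten[b]? = some a → ∃ S, L[σ b]? = some S ∧ S[β b]? = some a) ∧
      LexMono L.flatten.length σ β := by
  induction L with
  | nil => exact ⟨id, id, by simp, fun b b' _ h => by simp at h⟩
  | cons S L ih =>
    obtain ⟨σ, β, h1, h2⟩ := ih
    refine ⟨fun b => if b < S.length then 0 else σ (b - S.length) + 1,
      fun b => if b < S.length then b else β (b - S.length), ?_, ?_⟩
    · intro b a hb
      rw [List.flatten_cons, List.getElem?_append] at hb
      by_cases h : b < S.length
      · simp only [h, if_true] at hb ⊢
        exact ⟨S, by simp, hb⟩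
      · simp only [h, if_false] at hb ⊢
        simpa using h1 _ _ hb
    · intro b b' hb hn
      rw [List.flatten_cons, List.length_append] at hn
      by_cases h : b < S.length
      · by_cases h' : b' < S.length
        · simp [h, h', hb]
        · simp [h, h']
      · have h' : ¬ b' < S.length := by omega
        have := h2 (b - S.length) (b' - S.length) (by omega) (by omega)
        simp only [h, h', if_false]
        omega

/-! ### Structure of compositions and shuffles -/

/-- Each block of `top ∘ mid` is a dead block of `top` or a renamed block of `mid`. -/
theorem exists_compose_index (top mid : BlockSeq) : ∃ σ β : ℕ → ℕ,
    (∀ b B, (compose top mid)[b]? = some B →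
      (∃ D, top[σ b]? = some (.dead D) ∧ B = .dead D ∧ β b = 0) ∨
      (∃ M E, top[σ b]? = some (.live M) ∧ mid[β b]? = some E ∧
        B = E.rename fun x => M.getD x 0)) ∧
      LexMono (compose top mid).length σ β := by
  unfold compose
  rw [List.flatMap_def]
  obtain ⟨σ, β, h1, h2⟩ := exists_flatten_index (top.map fun
    | Block.live B => mid.rename fun x => B.getD x 0
    | Block.dead B => [Block.dead B])
  refine ⟨σ, β, fun b B hb => ?_, h2⟩
  obtain ⟨S, hS, hB⟩ := h1 b B hb
  rw [List.getElem?_map, Option.map_eq_some_iff] at hS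
  obtain ⟨E, hE, rfl⟩ := hS
  cases E with
  | dead D =>
    left
    refine ⟨D, hE, ?_⟩
    cases hβ : β b with
    | zero => simpa [hβ, eq_comm] using hB
    | succ n => simp [hβ] at hB
  | live M =>
    right
    simp only [rename, List.getElem?_map, Option.map_eq_some_iff] at hB
    obtain ⟨E, hE', rfl⟩ := hB
    exact ⟨M, E, hE, hE', rfl⟩

@[simp] theorem numLive_nil : numLive [] = 0 := rfl

@[simp] theorem numLive_cons_live (B : List ℕ) (T : BlockSeq) :
    numLive (.live B :: T) = numLive T + 1 :=
  List.countP_cons_of_pos rfl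

@[simp] theorem numLive_cons_dead (B : List ℕ) (T : BlockSeq) :
    numLive (.dead B :: T) = numLive T :=
  List.countP_cons_of_neg (by simp [Block.isLive])

@[simp] theorem numLive_append (S T : BlockSeq) :
    numLive (S ++ T) = numLive S + numLive T :=
  List.countP_append

/-- The number of live blocks before the block with index `b`. -/
def liveRank (T : BlockSeq) (b : ℕ) : ℕ := numLive (T.take b)

theorem liveRank_lt {T : BlockSeq} {b b' : ℕ} {B : List ℕ} (h : T[b]? = some (.live B))
    (hb : b < b') : liveRank T b < liveRank T b' := by
  unfold liveRank numLive
  obtain ⟨hlt, he⟩ := List.getElem?_eq_some_iff.1 h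
  have h1 : (T.take (b + 1)).countP Block.isLive ≤ (T.take b').countP Block.isLive :=
    (List.take_sublist_take_left (by omega)).countP_le
  rw [List.take_succ_eq_append_getElem hlt, List.countP_append, he] at h1
  simp [Block.isLive] at h1
  omega

theorem liveRank_inj {T : BlockSeq} {b b' : ℕ} {B B' : List ℕ} (h : T[b]? = some (.live B))
    (h' : T[b']? = some (.live B')) (he : liveRank T b = liveRank T b') : b = b' := by
  rcases lt_trichotomy b b' with hb | hb | hb
  · have := liveRank_lt h hb; omega
  · exact hb
  · have := liveRank_lt h' hb; omega

/-- The live block of rank `p` receives the `p`-th symbol. -/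
theorem insertLive_getElem? (as : List ℕ) (T : BlockSeq) (h : as.length = numLive T) (b : ℕ)
    (B : Block) (hB : (insertLive true as T)[b]? = some B) :
    (∃ D, T[b]? = some (.dead D) ∧ B = .dead D) ∨
    (∃ D x, T[b]? = some (.live D) ∧ as[liveRank T b]? = some x ∧ B = .live (x :: D)) := by
  induction T generalizing as b with
  | nil => simp [insertLive] at hB
  | cons E T ih =>
    cases E with
    | dead D =>
      simp only [insertLive] at hB
      cases b with
      | zero => left; simpa [eq_comm] using hB
      | succ b =>
        have := ih as (by simpa using h) b (by simpa using hB)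
        simpa [liveRank] using this
    | live D =>
      cases as with
      | nil => simp at h
      | cons a as =>
        simp only [insertLive] at hB
        cases b with
        | zero =>
          right
          exact ⟨D, a, by simp, by simp [liveRank], by simpa [eq_comm] using hB⟩
        | succ b =>
          have := ih as (by simpa using h) b (by simpa using hB)
          simpa [liveRank] using this

/-- The segments that replace the blocks of `sub` in a preshuffle of `sub` and `bot`. -/
def shuffleSegments (bot : BlockSeq) : ℕ → BlockSeq → List BlockSeq
  | _, [] => []
  | q, Block.dead B :: T => [Block.dead (B.map (Nat.pair 0))] :: shuffleSegments bot q T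
  | q, Block.live B :: T =>
      insertLive true (B.map (Nat.pair 0)) (bot.rename (Nat.pair (q + 1))) ::
        shuffleSegments bot (q + 1) T

theorem flatten_shuffleSegments (bot : BlockSeq) (q : ℕ) (sub : BlockSeq) :
    (shuffleSegments bot q sub).flatten = shuffleFrom true bot q sub := by
  induction sub generalizing q with
  | nil => rfl
  | cons B T ih => cases B <;> simp [shuffleSegments, shuffleFrom, ih]

theorem shuffleSegments_getElem? (bot : BlockSeq) (q : ℕ) (sub : BlockSeq) (s : ℕ)
    (S : BlockSeq) (hS : (shuffleSegments bot q sub)[s]? = some S) :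
    (∃ D, sub[s]? = some (.dead D) ∧ S = [.dead (D.map (Nat.pair 0))]) ∨
    (∃ M, sub[s]? = some (.live M) ∧ S = insertLive true (M.map (Nat.pair 0))
      (bot.rename (Nat.pair (q + liveRank sub s + 1)))) := by
  induction sub generalizing q s with
  | nil => simp [shuffleSegments] at hS
  | cons E T ih =>
    cases E with
    | dead D =>
      cases s with
      | zero => left; simpa [shuffleSegments, eq_comm] using hS
      | succ s =>
        have := ih q s (by simpa [shuffleSegments] using hS)
        simpa [liveRank] using this
    | live D =>
      cases s with
      | zero => right; simpa [shuffleSegments, eq_comm, liveRank] using hS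
      | succ s =>
        have := ih (q + 1) s (by simpa [shuffleSegments] using hS)
        simpa [liveRank, add_assoc, add_comm, add_left_comm] using this

theorem numLive_rename (f : ℕ → ℕ) (T : BlockSeq) : numLive (T.rename f) = numLive T := by
  unfold numLive rename
  rw [List.countP_map]
  congr 1
  funext B
  cases B <;> rfl

theorem liveRank_rename (f : ℕ → ℕ) (T : BlockSeq) (b : ℕ) :
    liveRank (T.rename f) b = liveRank T b := by
  unfold liveRank
  rw [← numLive_rename f (T.take b)]
  simp [rename, List.map_take]

/-- Each block of a preshuffle is a dead block of `U`, or a block of a copy of `bot` that has, if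
it is live, one symbol of `U` in front. -/
theorem exists_shuffle_index (U bot : BlockSeq)
    (hU : ∀ M, Block.live M ∈ U → M.length = bot.numLive) : ∃ σ β : ℕ → ℕ,
    (∀ b B, (shuffleFrom true bot 0 U)[b]? = some B →
      (∃ D, U[σ b]? = some (.dead D) ∧ B = .dead (D.map (Nat.pair 0)) ∧ β b = 0) ∨
      (∃ M D, U[σ b]? = some (.live M) ∧ bot[β b]? = some (.dead D) ∧
        B = .dead (D.map (Nat.pair (liveRank U (σ b) + 1)))) ∨
      (∃ M D x, U[σ b]? = some (.live M) ∧ bot[β b]? = some (.live D) ∧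
        M[liveRank bot (β b)]? = some x ∧
        B = .live (Nat.pair 0 x :: D.map (Nat.pair (liveRank U (σ b) + 1))))) ∧
      LexMono (shuffleFrom true bot 0 U).length σ β := by
  rw [← flatten_shuffleSegments]
  obtain ⟨σ, β, h1, h2⟩ := exists_flatten_index (shuffleSegments bot 0 U)
  refine ⟨σ, β, fun b B hb => ?_, h2⟩
  obtain ⟨S, hS, hB⟩ := h1 b B hb
  rcases shuffleSegments_getElem? bot 0 U (σ b) S hS with ⟨D, hD, rfl⟩ | ⟨M, hM, rfl⟩
  · left
    refine ⟨D, hD, ?_⟩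
    cases hβ : β b with
    | zero => simpa [hβ, eq_comm] using hB
    | succ n => simp [hβ] at hB
  · right
    have hlen : (M.map (Nat.pair 0)).length =
        numLive (bot.rename (Nat.pair (0 + liveRank U (σ b) + 1))) := by
      rw [numLive_rename, List.length_map, hU M (List.mem_of_getElem? hM)]
    rcases insertLive_getElem? _ _ hlen _ _ hB with ⟨D, hD, rfl⟩ | ⟨D, x, hD, hx, rfl⟩
    · left
      rw [rename, List.getElem?_map, Option.map_eq_some_iff] at hD
      obtain ⟨E, hE, hD⟩ := hD
      cases E with
      | live _ => simp [Block.rename] at hD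
      | dead E =>
        simp only [Block.rename, Block.dead.injEq] at hD
        exact ⟨M, E, hM, hE, by rw [← hD]; simp⟩
    · right
      rw [liveRank_rename, List.getElem?_map, Option.map_eq_some_iff] at hx
      obtain ⟨x, hx, rfl⟩ := hx
      rw [rename, List.getElem?_map, Option.map_eq_some_iff] at hD
      obtain ⟨E, hE, hD⟩ := hD
      cases E with
      | dead _ => simp [Block.rename] at hD
      | live E =>
        simp only [Block.rename, Block.live.injEq] at hD
        exact ⟨M, E, x, hM, hE, hx, by rw [← hD]; simp⟩

/-! ### Invariants of blocked sequences -/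

/-- The symbols of every block are distinct. -/
def NodupBlocks (T : BlockSeq) : Prop := ∀ B ∈ T, B.symbols.Nodup

/-- The occurrence of a symbol in a live block precedes its occurrences in all other blocks.  In
particular every symbol occurs in at most one live block. -/
def FirstLive (T : BlockSeq) : Prop :=
  ∀ (b : ℕ) (M : List ℕ) (x : ℕ) (P : ℕ × ℕ), T[b]? = some (.live M) → x ∈ M → Occ T P x → b ≤ P.1

/-- After a live block `(b_1, …, b_l)`, all occurrences of `b_l` come first, then all those of
`b_{l-1}`, and so on: the symbols of the block return in reversed order. -/
def Reversing (T : BlockSeq) : Prop :=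
  ∀ (b : ℕ) (M : List ℕ) (s t x y : ℕ) (P Q : ℕ × ℕ), T[b]? = some (.live M) → s < t →
    M[s]? = some x → M[t]? = some y → Occ T P x → Occ T Q y → b < P.1 → b < Q.1 → ¬ Before P Q

theorem Occ.eq_of_fst_eq {T : BlockSeq} (hT : NodupBlocks T) {P Q : ℕ × ℕ} {x : ℕ}
    (h : Occ T P x) (h' : Occ T Q x) (he : P.1 = Q.1) : P = Q := by
  obtain ⟨B, hB, hx⟩ := h
  obtain ⟨B', hB', hx'⟩ := h'
  rw [← he, hB, Option.some.injEq] at hB'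
  subst hB'
  have hn := hT B (List.mem_of_getElem? hB)
  have hlt := (List.getElem?_eq_some_iff.1 hx).1
  exact Prod.ext he ((List.getElem?_inj hlt hn).1 (hx.trans hx'.symm))

theorem Occ.unique {T : BlockSeq} {P : ℕ × ℕ} {x y : ℕ} (h : Occ T P x) (h' : Occ T P y) :
    x = y := by
  obtain ⟨B, hB, hx⟩ := h
  obtain ⟨B', hB', hx'⟩ := h'
  rw [hB, Option.some.injEq] at hB'
  subst hB'
  exact Option.some.inj (hx.symm.trans hx')

theorem Occ.mem_live {T : BlockSeq} {P : ℕ × ℕ} {x : ℕ} {M : List ℕ} (h : Occ T P x)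
    (hM : T[P.1]? = some (.live M)) : x ∈ M := by
  obtain ⟨B, hB, hx⟩ := h
  rw [hM, Option.some.injEq] at hB
  subst hB
  exact List.mem_of_getElem? hx

/-- Two symbols of a live block do not alternate after it. -/
theorem Reversing.not_alternating {T : BlockSeq} (hT : Reversing T) {b : ℕ} {M : List ℕ}
    (hM : T[b]? = some (.live M)) {x y : ℕ} (hx : x ∈ M) (hy : y ∈ M) (hxy : x ≠ y)
    {P Q R : ℕ × ℕ} (hP : Occ T P x) (hQ : Occ T Q y) (hR : Occ T R x) (hb : b < P.1)
    (hPQ : Before P Q) (hQR : Before Q R) : False := by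
  obtain ⟨s, hs⟩ := List.mem_iff_getElem?.1 hx
  obtain ⟨t, ht⟩ := List.mem_iff_getElem?.1 hy
  have hbQ : b < Q.1 := hb.trans_le hPQ.fst_le
  have hbR : b < R.1 := hbQ.trans_le hQR.fst_le
  rcases lt_trichotomy s t with h | h | h
  · exact hT b M s t x y P Q hM h hs ht hP hQ hb hbQ hPQ
  · subst h
    rw [hs, Option.some.injEq] at ht
    exact hxy ht
  · exact hT b M t s y x Q R hM h ht hs hQ hR hbQ hbR hQR

/-! ### Combs at positions -/

/-- An occurrence of the comb in `T`: symbols `a 0, …, a k` at positions `p 0, …, p k`,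
consecutive ones being related by `ρ`, then the symbol `z` of the teeth at position `r 0`, then
alternately `a i` at position `q i` and `z` at position `r (i + 1)`. -/
structure CombAt (T : BlockSeq) (k : ℕ) (ρ : ℕ × ℕ → ℕ × ℕ → Prop) (a : ℕ → ℕ) (z : ℕ)
    (p q r : ℕ → ℕ × ℕ) : Prop where
  ne : ∀ i ≤ k, a i ≠ z
  a_ne : ∀ i < k, a i ≠ a (i + 1)
  p_occ : ∀ i ≤ k, Occ T (p i) (a i)
  q_occ : ∀ i ≤ k, Occ T (q i) (a i)
  r_occ : ∀ i ≤ k + 1, Occ T (r i) z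
  p_p : ∀ i < k, ρ (p i) (p (i + 1))
  p_r : ∀ i ≤ k, Before (p i) (r 0)
  r_q : ∀ i ≤ k, Before (r i) (q i)
  q_r : ∀ i ≤ k, Before (q i) (r (i + 1))

/-- The order of positions in which the positions of a live block are not distinguished. -/
def WeakBefore (T : BlockSeq) (P Q : ℕ × ℕ) : Prop :=
  Before P Q ∨ P.1 = Q.1 ∧ ∃ M, T[P.1]? = some (.live M)

/-- `T` contains no comb, not even one whose initial symbols `a 0, …, a k` are in a different
order where their positions share a live block. This is the form of freeness that is preserved by
shuffling. -/
def CombFree (T : BlockSeq) (k : ℕ) : Prop :=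
  ∀ a z p q r, ¬ CombAt T k (WeakBefore T) a z p q r

namespace CombAt

variable {T : BlockSeq} {k : ℕ} {ρ : ℕ × ℕ → ℕ × ℕ → Prop} {a : ℕ → ℕ} {z : ℕ}
  {p q r : ℕ → ℕ × ℕ}

theorem r_before (h : CombAt T k ρ a z p q r) {i j : ℕ} (hij : i < j) (hj : j ≤ k + 1) :
    Before (r i) (r j) := by
  induction j, hij using Nat.le_induction with
  | base => exact (h.r_q i (by omega)).trans (h.q_r i (by omega))
  | succ j hij ih =>
    exact (ih (by omega)).trans ((h.r_q j (by omega)).trans (h.q_r j (by omega)))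

theorem r_before_q (h : CombAt T k ρ a z p q r) {i j : ℕ} (hij : i ≤ j) (hj : j ≤ k) :
    Before (r i) (q j) := by
  rcases hij.eq_or_lt with rfl | hij
  · exact h.r_q i hj
  · exact (h.r_before hij (by omega)).trans (h.r_q j hj)

theorem q_before (h : CombAt T k ρ a z p q r) {i j : ℕ} (hij : i < j) (hj : j ≤ k) :
    Before (q i) (q j) :=
  (h.q_r i (by omega)).trans (h.r_before_q hij hj)

theorem q_before_r (h : CombAt T k ρ a z p q r) {i j : ℕ} (hij : i < j) (hj : j ≤ k + 1) :
    Before (q i) (r j) := by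
  rcases (Nat.succ_le_of_lt hij).eq_or_lt with rfl | hij'
  · exact h.q_r i (by omega)
  · exact (h.q_r i (by omega)).trans (h.r_before hij' hj)

theorem p_before_q (h : CombAt T k ρ a z p q r) {i j : ℕ} (hi : i ≤ k) (hj : j ≤ k) :
    Before (p i) (q j) :=
  (h.p_r i hi).trans (h.r_before_q (Nat.zero_le j) hj)

theorem p_fst_le (h : CombAt T k ρ a z p q r) (hρ : ∀ P Q, ρ P Q → P.1 ≤ Q.1) {i j : ℕ}
    (hij : i ≤ j) (hj : j ≤ k) : (p i).1 ≤ (p j).1 := by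
  induction j, hij using Nat.le_induction with
  | base => exact le_rfl
  | succ j hij ih => exact (ih (by omega)).trans (hρ _ _ (h.p_p j (by omega)))

end CombAt

/-! ### Combs in compositions -/

/-- `σ` and `β` map the index of a block of `U = top ∘ mid` to the index of the block of `top` it
comes from and, if that block is live, to its index in the copy of `mid`. -/
structure ComposeIndex (U top mid : BlockSeq) (σ β : ℕ → ℕ) : Prop where
  mono : LexMono U.length σ β
  occ : ∀ P x, Occ U P x →
    (∃ D, top[σ P.1]? = some (.dead D) ∧ D[P.2]? = some x ∧ β P.1 = 0) ∨
    (∃ M y, top[σ P.1]? = some (.live M) ∧ M[y]? = some x ∧ Occ mid (β P.1, P.2) y)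
  live : ∀ (b : ℕ) (B : List ℕ), U[b]? = some (.live B) → ∃ M E, top[σ b]? = some (.live M) ∧
    mid[β b]? = some (.live E) ∧ ∀ t x : ℕ, B[t]? = some x → ∃ y, E[t]? = some y ∧ M[y]? = some x

theorem exists_composeIndex {top mid : BlockSeq}
    (htop : ∀ M x, .live M ∈ top → x ∈ symbols mid → x < M.length) :
    ∃ σ β, ComposeIndex (compose top mid) top mid σ β := by
  obtain ⟨σ, β, h1, h2⟩ := exists_compose_index top mid
  refine ⟨σ, β, h2, ?_, ?_⟩
  · rintro P x ⟨B, hB, hx⟩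
    rcases h1 _ _ hB with ⟨D, hD, rfl, h0⟩ | ⟨M, E, hM, hE, rfl⟩
    · exact .inl ⟨D, hD, hx, h0⟩
    · right
      have hx' : (E.symbols.map fun x => M.getD x 0)[P.2]? = some x := by
        cases E <;> exact hx
      rw [List.getElem?_map, Option.map_eq_some_iff] at hx'
      obtain ⟨y, hy, rfl⟩ := hx'
      have hocc : Occ mid (β P.1, P.2) y := ⟨E, hE, hy⟩
      have hlt := htop M y (List.mem_of_getElem? hM) hocc.mem
      exact ⟨M, y, hM, by simp [hlt], hocc⟩
  · intro b B hB
    rcases h1 _ _ hB with ⟨D, hD, h, -⟩ | ⟨M, E, hM, hE, h⟩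
    · cases h
    · cases E with
      | dead E => cases h
      | live E =>
        refine ⟨M, E, hM, hE, fun t x hx => ?_⟩
        simp only [Block.rename, Block.live.injEq] at h
        rw [h, List.getElem?_map, Option.map_eq_some_iff] at hx
        obtain ⟨y, hy, rfl⟩ := hx
        have hocc : Occ mid (β b, t) y := ⟨_, hE, hy⟩
        have hlt := htop M y (List.mem_of_getElem? hM) hocc.mem
        exact ⟨y, hy, by simp [hlt]⟩

namespace ComposeIndex

variable {U top mid : BlockSeq} {σ β : ℕ → ℕ}

theorem occ_top (h : ComposeIndex U top mid σ β) {P : ℕ × ℕ} {x : ℕ} (hP : Occ U P x) :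
    ∃ t, Occ top (σ P.1, t) x := by
  rcases h.occ P x hP with ⟨D, hD, hx, -⟩ | ⟨M, y, hM, hy, -⟩
  · exact ⟨_, _, hD, hx⟩
  · exact ⟨_, _, hM, hy⟩

theorem le (h : ComposeIndex U top mid σ β) {P Q : ℕ × ℕ} {x : ℕ} (hQ : Occ U Q x)
    (hPQ : Before P Q) : σ P.1 ≤ σ Q.1 :=
  h.mono.le hPQ.fst_le hQ.lt_length

theorem occ_mid (h : ComposeIndex U top mid σ β) (htop : NodupBlocks top) {P : ℕ × ℕ} {x : ℕ}
    (hP : Occ U P x) {M : List ℕ} (hM : top[σ P.1]? = some (.live M)) :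
    Occ mid (β P.1, P.2) (M.idxOf x) := by
  rcases h.occ P x hP with ⟨D, hD, -⟩ | ⟨M', y, hM', hy, hocc⟩
  · rw [hD] at hM; cases hM
  · rw [hM', Option.some.injEq, Block.live.injEq] at hM
    subst hM
    obtain ⟨hlt, rfl⟩ := List.getElem?_eq_some_iff.1 hy
    have hn : M'.Nodup := htop _ (List.mem_of_getElem? hM')
    rwa [hn.idxOf_getElem]

theorem mem_of_live (h : ComposeIndex U top mid σ β) {P : ℕ × ℕ} {x : ℕ}
    (hP : Occ U P x) {M : List ℕ} (hM : top[σ P.1]? = some (.live M)) : x ∈ M := by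
  obtain ⟨t, ht⟩ := h.occ_top hP
  exact ht.mem_live hM

theorem before_mid (h : ComposeIndex U top mid σ β) {P Q : ℕ × ℕ} {x : ℕ} (hQ : Occ U Q x)
    (hPQ : Before P Q) (hs : σ P.1 = σ Q.1) : Before (β P.1, P.2) (β Q.1, Q.2) := by
  rcases hPQ with hPQ | ⟨h1, h2⟩
  · rcases h.mono _ _ hPQ hQ.lt_length with h' | ⟨-, h'⟩
    · omega
    · exact .inl h'
  · exact .inr ⟨by simp [h1], h2⟩

/-- Positions of `U` can be mapped to positions of `top`. The order is preserved except inside the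
copies of `mid`. -/
theorem exists_topPos (h : ComposeIndex U top mid σ β) : ∃ f : ℕ × ℕ → ℕ × ℕ,
    (∀ P x, Occ U P x → Occ top (f P) x ∧ (f P).1 = σ P.1) ∧
    (∀ P Q x y, Occ U P x → Occ U Q y → Before P Q →
      (σ P.1 = σ Q.1 → ∃ D, top[σ P.1]? = some (.dead D)) → Before (f P) (f Q)) := by
  have key : ∀ P, ∃ P' : ℕ × ℕ, ∀ x, Occ U P x → Occ top P' x ∧ P'.1 = σ P.1 ∧
      ∀ D, top[σ P.1]? = some (.dead D) → P'.2 = P.2 ∧ β P.1 = 0 := by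
    intro P
    by_cases hP : ∃ x, Occ U P x
    · obtain ⟨x, hx⟩ := hP
      rcases h.occ P x hx with ⟨D, hD, hDx, h0⟩ | ⟨M, y, hM, hy, -⟩
      · refine ⟨(σ P.1, P.2), fun x' hx' => ?_⟩
        rw [← hx.unique hx']
        exact ⟨⟨_, hD, hDx⟩, rfl, fun _ _ => ⟨rfl, h0⟩⟩
      · refine ⟨(σ P.1, y), fun x' hx' => ?_⟩
        rw [← hx.unique hx']
        exact ⟨⟨_, hM, hy⟩, rfl, fun D hD => by rw [hM] at hD; cases hD⟩
    · exact ⟨P, fun x hx => (hP ⟨x, hx⟩).elim⟩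
  choose f hf using key
  refine ⟨f, fun P x hP => ⟨(hf P x hP).1, (hf P x hP).2.1⟩, fun P Q x y hP hQ hPQ hd => ?_⟩
  obtain ⟨-, hP1, hP2⟩ := hf P x hP
  obtain ⟨-, hQ1, hQ2⟩ := hf Q y hQ
  rcases (h.le hQ hPQ).eq_or_lt with he | hlt
  · obtain ⟨D, hD⟩ := hd he
    obtain ⟨h1, h2⟩ := hP2 D hD
    obtain ⟨h3, h4⟩ := hQ2 D (he ▸ hD)
    refine .inr ⟨by omega, ?_⟩
    rcases hPQ with hPQ | ⟨-, hPQ⟩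
    · have := h.mono _ _ hPQ hQ.lt_length
      omega
    · omega
  · exact .inl (by omega)

theorem not_before (h : ComposeIndex U top mid σ β) (hf : FirstLive top) (hr : Reversing top)
    {b s t x y : ℕ} {M : List ℕ} {P Q : ℕ × ℕ} (hM : top[b]? = some (.live M)) (hst : s < t)
    (hs : M[s]? = some x) (ht : M[t]? = some y) (hP : Occ U P x) (hQ : Occ U Q y)
    (hbP : b < σ P.1) (hbQ : b < σ Q.1) : ¬ Before P Q := by
  intro hPQ
  obtain ⟨f, hf1, hf2⟩ := h.exists_topPos
  obtain ⟨hP1, hP2⟩ := hf1 P x hP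
  obtain ⟨hQ1, hQ2⟩ := hf1 Q y hQ
  refine hr b M s t x y (f P) (f Q) hM hst hs ht hP1 hQ1 (by omega) (by omega)
    (hf2 P Q x y hP hQ hPQ fun _ => ?_)
  -- The block of `P` in `top` is dead, as `x` occurs in the earlier live block `b`.
  obtain ⟨B, hB, hx⟩ := id hP1
  rw [hP2] at hB
  cases B with
  | dead D => exact ⟨D, hB⟩
  | live M' =>
    have := hf _ M' x (b, s) hB (List.mem_of_getElem? hx) ⟨_, hM, hs⟩
    simp only at this
    omega

theorem not_alternating (h : ComposeIndex U top mid σ β) (hf : FirstLive top)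
    (hr : Reversing top) {b : ℕ} {M : List ℕ} (hM : top[b]? = some (.live M)) {x y : ℕ}
    (hx : x ∈ M) (hy : y ∈ M) (hxy : x ≠ y) {P Q R : ℕ × ℕ} (hP : Occ U P x) (hQ : Occ U Q y)
    (hR : Occ U R x) (hb : b < σ P.1) (hPQ : Before P Q) (hQR : Before Q R) : False := by
  obtain ⟨s, hs⟩ := List.mem_iff_getElem?.1 hx
  obtain ⟨t, ht⟩ := List.mem_iff_getElem?.1 hy
  have hbQ : b < σ Q.1 := hb.trans_le (h.le hQ hPQ)
  have hbR : b < σ R.1 := hbQ.trans_le (h.le hR hQR)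
  rcases lt_trichotomy s t with hst | hst | hst
  · exact h.not_before hf hr hM hst hs ht hP hQ hb hbQ hPQ
  · subst hst
    rw [hs, Option.some.injEq] at ht
    exact hxy ht
  · exact h.not_before hf hr hM hst ht hs hQ hR hbQ hbR hQR

end ComposeIndex

/-- The blocked sequence `(1 2 ⋯ l) ⟨1 2 ⋯ l⟩`. -/
def twoUp (l : ℕ) : BlockSeq := [.live (List.range l), .dead (List.range l)]

theorem Occ.of_twoUp {l : ℕ} {P : ℕ × ℕ} {x : ℕ} (h : Occ (twoUp l) P x) :
    P.1 < 2 ∧ P.2 = x := by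
  obtain ⟨B, hB, hx⟩ := h
  have h2 : P.1 < 2 := (List.getElem?_eq_some_iff.1 hB).1
  have hB' : B.symbols = List.range l := by
    obtain ⟨P1, P2⟩ := P
    simp only at hB h2
    interval_cases P1 <;> simp [twoUp] at hB <;> subst hB <;> rfl
  rw [hB', List.getElem?_eq_some_iff] at hx
  simp only [List.length_range, List.getElem_range] at hx
  exact ⟨h2, hx.2⟩

/-- What a sequence `mid` has to satisfy so that compositions and shuffles over it avoid the comb
with parameter `k`. -/
def MidAdmissible (k : ℕ) (mid : BlockSeq) : Prop :=
  (k = 1 ∧ ∃ l, mid = twoUp l) ∨ (2 ≤ k ∧ Reversing mid ∧ CombFree mid (k - 1))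

section Compose

variable {U top mid : BlockSeq} {σ β : ℕ → ℕ} {k : ℕ}

/-- In a comb of `top ∘ mid`, no symbol `a i` between two teeth lies in the copy of `mid` for a live
block of `top` that also contains the symbol of the teeth.  Otherwise the comb lies in this copy up
to its last two symbols. -/
theorem ComposeIndex.not_mem_live (h : ComposeIndex U top mid σ β) (hn : NodupBlocks top)
    (hf : FirstLive top) (hr : Reversing top) (hmid : MidAdmissible k mid)
    {a : ℕ → ℕ} {z : ℕ} {p q r : ℕ → ℕ × ℕ} (hc : CombAt U k Before a z p q r) {i : ℕ}
    (hi : i ≤ k) {M : List ℕ} (hM : top[σ (q i).1]? = some (.live M)) (hz : z ∈ M) : False := by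
  set s := σ (q i).1 with hs
  -- Occurrences of symbols of `M` lie in or after the block `s`.
  have first : ∀ {P x}, x ∈ M → Occ U P x → s ≤ σ P.1 := by
    intro P x hx hP
    obtain ⟨t, ht⟩ := h.occ_top hP
    exact hf s M x _ hM hx ht
  have hai : a i ∈ M := h.mem_of_live (hc.q_occ i hi) hM
  have hpi := first hai (hc.p_occ i hi)
  have hr0 : σ (r 0).1 = s := le_antisymm
    (h.le (hc.q_occ i hi) (hc.r_before_q (Nat.zero_le i) hi))
    (hpi.trans (h.le (hc.r_occ 0 (by omega)) (hc.p_r i hi)))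
  have hq0 : σ (q 0).1 = s := by
    refine le_antisymm ?_ (hr0 ▸ h.le (hc.q_occ 0 (by omega)) (hc.r_q 0 (by omega)))
    rcases Nat.eq_zero_or_pos i with rfl | h0
    · exact le_rfl
    · exact h.le (hc.q_occ i hi) (hc.q_before h0 hi)
  have ha0 : a 0 ∈ M := h.mem_of_live (hc.q_occ 0 (by omega)) (hq0 ▸ hM)
  have hp : ∀ j ≤ k, σ (p j).1 = s := fun j hj => le_antisymm
    (hr0 ▸ h.le (hc.r_occ 0 (by omega)) (hc.p_r j hj))
    ((first ha0 (hc.p_occ 0 (by omega))).trans (h.mono.le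
      (hc.p_fst_le (fun _ _ h => h.fst_le) (Nat.zero_le j) hj) (hc.p_occ j hj).lt_length))
  have ha : ∀ j ≤ k, a j ∈ M := fun j hj => h.mem_of_live (hc.p_occ j hj) (hp j hj ▸ hM)
  -- Otherwise `z a_k z` follows the block `s` in `top`.
  have hrk : σ (r k).1 = s := by
    by_contra hne
    have hlt : s < σ (r k).1 :=
      lt_of_le_of_ne (first hz (hc.r_occ k (by omega))) (Ne.symm hne)
    exact h.not_alternating hf hr hM hz (ha k le_rfl) (hc.ne k le_rfl).symm
      (hc.r_occ k (by omega)) (hc.q_occ k le_rfl) (hc.r_occ (k + 1) le_rfl) hlt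
      (hc.r_q k le_rfl) (hc.q_r k le_rfl)
  have hrj : ∀ j ≤ k, σ (r j).1 = s := fun j hj => le_antisymm
    (by
      rcases hj.eq_or_lt with rfl | hj
      · exact hrk.le
      · exact hrk ▸ h.le (hc.r_occ k (by omega)) (hc.r_before hj (by omega)))
    (first hz (hc.r_occ j (by omega)))
  have hqj : ∀ j < k, σ (q j).1 = s := fun j hj => le_antisymm
    (hrk ▸ h.le (hc.r_occ k (by omega)) (hc.q_before_r hj (by omega)))
    (first (ha j hj.le) (hc.q_occ j hj.le))
  have occ : ∀ {P x}, Occ U P x → σ P.1 = s → Occ mid (β P.1, P.2) (M.idxOf x) :=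
    fun hP hs => h.occ_mid hn hP (hs ▸ hM)
  have bef : ∀ {P Q x}, Occ U Q x → Before P Q → σ P.1 = s → σ Q.1 = s →
      Before (β P.1, P.2) (β Q.1, Q.2) := fun hQ hPQ hs ht =>
    h.before_mid hQ hPQ (hs.trans ht.symm)
  rcases hmid with ⟨rfl, l, rfl⟩ | ⟨hk, -, hfree⟩
  · -- For `k = 1` the copy of `(1 2 ⋯ l) ⟨1 2 ⋯ l⟩` contains `a_0 a_1 z | a_0 z`, so `a_1`
    -- precedes `z` in `M`, while the symbols of `M` return in reversed order in `top`, contrary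
    -- to the final `a_1 z`.
    have op0 := (occ (hc.p_occ 0 (by omega)) (hp 0 (by omega))).of_twoUp
    have op1 := (occ (hc.p_occ 1 le_rfl) (hp 1 le_rfl)).of_twoUp
    have or0 := (occ (hc.r_occ 0 (by omega)) (hrj 0 (by omega))).of_twoUp
    have oq0 := (occ (hc.q_occ 0 (by omega)) (hqj 0 (by omega))).of_twoUp
    have or1 := (occ (hc.r_occ 1 (by omega)) (hrj 1 le_rfl)).of_twoUp
    have b1 := bef (hc.r_occ 0 (by omega)) (hc.p_r 1 le_rfl) (hp 1 le_rfl) (hrj 0 (by omega))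
    have b2 := bef (hc.q_occ 0 (by omega)) (hc.p_before_q (Nat.zero_le 1) (Nat.zero_le 1))
      (hp 0 (by omega)) (hqj 0 (by omega))
    have b3 := bef (hc.r_occ 1 (by omega)) (hc.q_r 0 (by omega)) (hqj 0 (by omega))
      (hrj 1 le_rfl)
    have b4 := bef (hc.r_occ 1 (by omega)) (hc.r_before (Nat.zero_lt_one) (by omega))
      (hrj 0 (by omega)) (hrj 1 le_rfl)
    simp only [Before] at op0 op1 or0 oq0 or1 b1 b2 b3 b4
    have hidx : M.idxOf (a 1) < M.idxOf z := by omega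
    have hs1 : s < σ (q 1).1 := by
      refine lt_of_le_of_ne (first (ha 1 le_rfl) (hc.q_occ 1 le_rfl)) fun he => ?_
      have oq1 := (occ (hc.q_occ 1 le_rfl) he.symm).of_twoUp
      have b5 := bef (hc.q_occ 1 le_rfl) (hc.r_q 1 le_rfl) (hrj 1 le_rfl) he.symm
      simp only [Before] at oq1 b5
      omega
    have hs2 : s < σ (r 2).1 := hs1.trans_le (h.le (hc.r_occ 2 le_rfl) (hc.q_r 1 le_rfl))
    exact h.not_before hf hr hM hidx (List.getElem?_idxOf (ha 1 le_rfl))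
      (List.getElem?_idxOf hz) (hc.q_occ 1 le_rfl) (hc.r_occ 2 le_rfl) hs1 hs2
      (hc.q_r 1 le_rfl)
  · have hne : ∀ x y, x ∈ M → x ≠ y → M.idxOf x ≠ M.idxOf y := fun x y hx hxy he =>
      hxy ((List.idxOf_inj hx).1 he)
    let g : ℕ × ℕ → ℕ × ℕ := fun P => (β P.1, P.2)
    refine hfree (fun j => M.idxOf (a j)) (M.idxOf z) (g ∘ p) (g ∘ q) (g ∘ r) ?_
    constructor
    · exact fun j hj => hne _ _ (ha j (by omega)) (hc.ne j (by omega))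
    · exact fun j hj => hne _ _ (ha j (by omega)) (hc.a_ne j (by omega))
    · exact fun j hj => occ (hc.p_occ j (by omega)) (hp j (by omega))
    · exact fun j hj => occ (hc.q_occ j (by omega)) (hqj j (by omega))
    · exact fun j hj => occ (hc.r_occ j (by omega)) (hrj j (by omega))
    · exact fun j hj => .inl (bef (hc.p_occ (j + 1) (by omega)) (hc.p_p j (by omega))
        (hp j (by omega)) (hp (j + 1) (by omega)))
    · exact fun j hj => bef (hc.r_occ 0 (by omega)) (hc.p_r j (by omega))
        (hp j (by omega)) (hrj 0 (by omega))
    · exact fun j hj => bef (hc.q_occ j (by omega)) (hc.r_q j (by omega))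
        (hrj j (by omega)) (hqj j (by omega))
    · exact fun j hj => bef (hc.r_occ (j + 1) (by omega)) (hc.q_r j (by omega))
        (hqj j (by omega)) (hrj (j + 1) (by omega))

/-- A comb of `top ∘ mid` yields one of `top`, in which the symbols `a i` that enter a common copy
of `mid` may be permuted. -/
theorem ComposeIndex.not_combAt (h : ComposeIndex U top mid σ β) (hk : 1 ≤ k)
    (hn : NodupBlocks top) (hf : FirstLive top) (hr : Reversing top) (hfree : CombFree top k)
    (hmid : MidAdmissible k mid) (a : ℕ → ℕ) (z : ℕ) (p q r : ℕ → ℕ × ℕ) :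
    ¬ CombAt U k Before a z p q r := by
  intro hc
  obtain ⟨f, hf1, hf2⟩ := h.exists_topPos
  have hq : ∀ i ≤ k, ∀ M, top[σ (q i).1]? = some (.live M) → z ∉ M := fun i hi M hM hz =>
    h.not_mem_live hn hf hr hmid hc hi hM hz
  have dead : ∀ {P x}, Occ U P x → (∀ M, top[σ P.1]? = some (.live M) → False) →
      ∃ D, top[σ P.1]? = some (.dead D) := by
    intro P x hP hno
    rcases h.occ P x hP with ⟨D, hD, -⟩ | ⟨M, y, hM, -⟩
    · exact ⟨D, hD⟩
    · exact (hno M hM).elim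
  refine hfree a z (f ∘ p) (f ∘ q) (f ∘ r) ⟨hc.ne, hc.a_ne, fun i hi => (hf1 _ _ (hc.p_occ i hi)).1,
    fun i hi => (hf1 _ _ (hc.q_occ i hi)).1, fun i hi => (hf1 _ _ (hc.r_occ i hi)).1,
    fun i hi => ?_, fun i hi => ?_, fun i hi => ?_, fun i hi => ?_⟩
  · have o1 := hc.p_occ i (by omega)
    have o2 := hc.p_occ (i + 1) (by omega)
    by_cases hl : σ (p i).1 = σ (p (i + 1)).1 ∧ ∃ M, top[σ (p i).1]? = some (.live M)
    · right
      rw [Function.comp, Function.comp, (hf1 _ _ o1).2, (hf1 _ _ o2).2]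
      exact hl
    · left
      exact hf2 _ _ _ _ o1 o2 (hc.p_p i hi) fun he => dead o1 fun M hM => hl ⟨he, M, hM⟩
  · have o1 := hc.p_occ i hi
    have o2 := hc.r_occ 0 (by omega)
    refine hf2 _ _ _ _ o1 o2 (hc.p_r i hi) fun he => dead o1 fun M hM => ?_
    -- Now `a k` and `z` are in `M`, and `z a_k z` follows in `top`.
    have hz : z ∈ M := h.mem_of_live o2 (he ▸ hM)
    have hpk : σ (p k).1 = σ (p i).1 := le_antisymm
      (he ▸ h.le o2 (hc.p_r k le_rfl))
      (h.mono.le (hc.p_fst_le (fun _ _ h => h.fst_le) hi le_rfl) (hc.p_occ k le_rfl).lt_length)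
    have hak : a k ∈ M := h.mem_of_live (hc.p_occ k le_rfl) (hpk ▸ hM)
    have l1 := h.le (hc.q_occ 0 (by omega)) (hc.r_q 0 (by omega))
    have hne : σ (q 0).1 ≠ σ (p i).1 := fun hq0 =>
      hq 0 (by omega) M (hq0 ▸ hM) hz
    have l2 := h.le (hc.r_occ 1 (by omega)) (hc.q_r 0 (by omega))
    have l3 : σ (r 1).1 ≤ σ (r k).1 := by
      rcases hk.eq_or_lt with rfl | hk
      · exact le_rfl
      · exact h.le (hc.r_occ k (by omega)) (hc.r_before hk (by omega))
    exact h.not_alternating hf hr hM hz hak (hc.ne k le_rfl).symm (hc.r_occ k (by omega))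
      (hc.q_occ k le_rfl) (hc.r_occ (k + 1) le_rfl) (by omega) (hc.r_q k le_rfl)
      (hc.q_r k le_rfl)
  · have o1 := hc.r_occ i (by omega)
    refine hf2 _ _ _ _ o1 (hc.q_occ i hi) (hc.r_q i hi) fun he => dead o1 fun M hM => ?_
    exact hq i hi M (he ▸ hM) (h.mem_of_live o1 hM)
  · have o1 := hc.q_occ i hi
    have o2 := hc.r_occ (i + 1) (by omega)
    refine hf2 _ _ _ _ o1 o2 (hc.q_r i hi) fun he => dead o1 fun M hM => ?_
    exact hq i hi M hM (h.mem_of_live o2 (he ▸ hM))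

/-- If a live block of `top ∘ mid` contains `x` before `z`, and also `y`, then it is not followed
by the teeth `z x z`, if `k = 1`, or `z x z y z`, if `k ≥ 2`. -/
theorem ComposeIndex.not_teeth (h : ComposeIndex U top mid σ β)
    (hn : NodupBlocks top) (hf : FirstLive top) (hr : Reversing top)
    (hmid : MidAdmissible k mid) {b s t x z : ℕ} {M : List ℕ} (hM : U[b]? = some (.live M))
    (hs : M[s]? = some x) (ht : M[t]? = some z) (hst : s < t) {R₀ Q₀ R₁ : ℕ × ℕ}
    (hb : b < R₀.1) (oR₀ : Occ U R₀ z) (oQ₀ : Occ U Q₀ x) (oR₁ : Occ U R₁ z)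
    (h₁ : Before R₀ Q₀) (h₂ : Before Q₀ R₁)
    (hy : 2 ≤ k → ∃ y ∈ M, y ≠ z ∧ ∃ Q₁ R₂, Occ U Q₁ y ∧ Occ U R₂ z ∧ Before R₁ Q₁ ∧ Before Q₁ R₂)
    (hxz : x ≠ z) : False := by
  obtain ⟨B, E, hB, hE, hME⟩ := h.live b M hM
  have hnB : B.Nodup := hn _ (List.mem_of_getElem? hB)
  have idx : ∀ {t x : ℕ}, M[t]? = some x → E[t]? = some (B.idxOf x) ∧ x ∈ B := by
    intro t x hx
    obtain ⟨y, hy1, hy2⟩ := hME t x hx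
    obtain ⟨hlt, rfl⟩ := List.getElem?_eq_some_iff.1 hy2
    rw [hnB.idxOf_getElem]
    exact ⟨hy1, List.getElem_mem _⟩
  have hxB := (idx hs).2
  have hzB := (idx ht).2
  have hne : ∀ {x y}, x ∈ B → x ≠ y → B.idxOf x ≠ B.idxOf y := fun hx hxy he =>
    hxy ((List.idxOf_inj hx).1 he)
  have l1 := h.le oQ₀ h₁
  have l2 := h.le oR₁ h₂
  have ge : σ b ≤ σ R₀.1 := h.mono.le hb.le oR₀.lt_length
  have hbeta : σ R₀.1 = σ b → β b < β R₀.1 := fun he => by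
    have := h.mono _ _ hb oR₀.lt_length
    omega
  rcases hmid with ⟨-, l, rfl⟩ | ⟨hk, hrm, -⟩
  · by_cases hq : σ Q₀.1 = σ b
    · have hr0 : σ R₀.1 = σ b := by omega
      have b1 := h.before_mid oQ₀ h₁ (hr0.trans hq.symm)
      have o1 := (h.occ_mid hn oR₀ (hr0 ▸ hB)).of_twoUp
      have o2 := (h.occ_mid hn oQ₀ (hq ▸ hB)).of_twoUp
      have o3 : Occ (twoUp l) (β b, s) (B.idxOf x) := ⟨_, hE, (idx hs).1⟩
      have o4 : Occ (twoUp l) (β b, t) (B.idxOf z) := ⟨_, hE, (idx ht).1⟩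
      have o3' := o3.of_twoUp
      have o4' := o4.of_twoUp
      have := hbeta hr0
      simp only [Before] at b1 o1 o2 o3' o4'
      omega
    · have hlt : B.idxOf x < B.idxOf z := by
        have o3 : Occ (twoUp l) (β b, s) (B.idxOf x) := ⟨_, hE, (idx hs).1⟩
        have o4 : Occ (twoUp l) (β b, t) (B.idxOf z) := ⟨_, hE, (idx ht).1⟩
        have o3' := o3.of_twoUp
        have o4' := o4.of_twoUp
        simp only at o3' o4'
        omega
      exact h.not_before hf hr hB hlt (List.getElem?_idxOf hxB) (List.getElem?_idxOf hzB)
        oQ₀ oR₁ (by omega) (by omega) h₂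
  · obtain ⟨y, hyM, hyz, Q₁, R₂, oQ₁, oR₂, h₃, h₄⟩ := hy hk
    obtain ⟨u, hu⟩ := List.mem_iff_getElem?.1 hyM
    by_cases hr1 : σ R₁.1 = σ b
    · have hr0 : σ R₀.1 = σ b := by omega
      have hq0 : σ Q₀.1 = σ b := by omega
      exact hrm.not_alternating hE (List.mem_of_getElem? (idx ht).1)
        (List.mem_of_getElem? (idx hs).1) (hne hzB hxz.symm) (h.occ_mid hn oR₀ (hr0 ▸ hB))
        (h.occ_mid hn oQ₀ (hq0 ▸ hB)) (h.occ_mid hn oR₁ (hr1 ▸ hB)) (hbeta hr0)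
        (h.before_mid oQ₀ h₁ (hr0.trans hq0.symm)) (h.before_mid oR₁ h₂ (hq0.trans hr1.symm))
    · exact h.not_alternating hf hr hB hzB (idx hu).2 hyz.symm oR₁ oQ₁ oR₂ (by omega) h₃ h₄

end Compose

/-! ### Combs in shuffles -/

/-- `σ`, `β` and `e` map the index of a block of `T`, the preshuffle of `U` and `bot`, to the index
of the block of `U` it comes from, and if that block is live, to its index in the copy of `bot` and
to the number of symbols inserted in front of the block of `bot`. -/
structure ShuffleIndex (T U bot : BlockSeq) (σ β e : ℕ → ℕ) : Prop where
  mono : LexMono T.length σ β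
  occ_sub : ∀ P y, Occ T P (Nat.pair 0 y) →
    (∃ D, U[σ P.1]? = some (.dead D) ∧ D[P.2]? = some y ∧ β P.1 = 0) ∨
    (∃ M D, U[σ P.1]? = some (.live M) ∧ bot[β P.1]? = some (.live D) ∧
      M[liveRank bot (β P.1)]? = some y ∧ P.2 = 0)
  occ_bot : ∀ P q y, Occ T P (Nat.pair (q + 1) y) → q = liveRank U (σ P.1) ∧
    (∃ M, U[σ P.1]? = some (.live M)) ∧ e P.1 ≤ P.2 ∧ Occ bot (β P.1, P.2 - e P.1) y
  live : ∀ (b : ℕ) (B : List ℕ), T[b]? = some (.live B) → ∃ M D x, U[σ b]? = some (.live M) ∧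
    bot[β b]? = some (.live D) ∧ M[liveRank bot (β b)]? = some x ∧
    B = Nat.pair 0 x :: D.map (Nat.pair (liveRank U (σ b) + 1))

theorem exists_shuffleIndex {U bot : BlockSeq}
    (hU : ∀ M, Block.live M ∈ U → M.length = bot.numLive) :
    ∃ σ β e, ShuffleIndex (shuffleFrom true bot 0 U) U bot σ β e := by
  obtain ⟨σ, β, h1, h2⟩ := exists_shuffle_index U bot hU
  refine ⟨σ, β, fun b => match bot[β b]? with | some (.live _) => 1 | _ => 0, h2, ?_, ?_, ?_⟩
  · rintro P y ⟨B, hB, hy⟩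
    rcases h1 _ _ hB with ⟨D, hD, rfl, h0⟩ | ⟨M, D, hM, hD, rfl⟩ | ⟨M, D, x, hM, hD, hx, rfl⟩
    · left
      refine ⟨D, hD, ?_, h0⟩
      simpa [Block.symbols, Nat.pair_eq_pair] using hy
    · simp [Block.symbols, Nat.pair_eq_pair] at hy
    · right
      refine ⟨M, D, hM, hD, ?_⟩
      cases hP : P.2 with
      | zero =>
        simp only [hP, Block.symbols, List.getElem?_cons_zero, Option.some.injEq,
          Nat.pair_eq_pair, true_and] at hy
        exact ⟨hy ▸ hx, rfl⟩
      | succ n => simp [hP, Block.symbols, Nat.pair_eq_pair] at hy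
  · rintro P q y ⟨B, hB, hy⟩
    rcases h1 _ _ hB with ⟨D, hD, rfl, h0⟩ | ⟨M, D, hM, hD, rfl⟩ | ⟨M, D, x, hM, hD, hx, rfl⟩
    · simp [Block.symbols, Nat.pair_eq_pair] at hy
    · simp only [Block.symbols, List.getElem?_map, Option.map_eq_some_iff, Nat.pair_eq_pair] at hy
      obtain ⟨y', hy', h3, rfl⟩ := hy
      simp only [hD]
      exact ⟨by omega, ⟨M, hM⟩, by omega, ⟨_, hD, hy'⟩⟩
    · simp only [hD]
      cases hP : P.2 with
      | zero => simp [hP, Block.symbols, Nat.pair_eq_pair] at hy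
      | succ n =>
        simp only [hP, Block.symbols, List.getElem?_cons_succ, List.getElem?_map,
          Option.map_eq_some_iff, Nat.pair_eq_pair] at hy
        obtain ⟨y', hy', h3, rfl⟩ := hy
        exact ⟨by omega, ⟨M, hM⟩, by omega, ⟨_, hD, hy'⟩⟩
  · intro b B hB
    rcases h1 _ _ hB with ⟨D, hD, h, h0⟩ | ⟨M, D, hM, hD, h⟩ | ⟨M, D, x, hM, hD, hx, h⟩
    · cases h
    · cases h
    · exact ⟨M, D, x, hM, hD, hx, by simpa using h⟩

namespace ShuffleIndex

variable {T U bot : BlockSeq} {σ β e : ℕ → ℕ}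

theorem le (h : ShuffleIndex T U bot σ β e) {P Q : ℕ × ℕ} {x : ℕ} (hQ : Occ T Q x)
    (hPQ : Before P Q) : σ P.1 ≤ σ Q.1 :=
  h.mono.le hPQ.fst_le hQ.lt_length

/-- Positions of symbols of `U` in the shuffle can be mapped to positions of `U`, preserving the
order. -/
theorem exists_subPos (h : ShuffleIndex T U bot σ β e) : ∃ f : ℕ × ℕ → ℕ × ℕ,
    (∀ P x, Occ T P (Nat.pair 0 x) → Occ U (f P) x ∧ (f P).1 = σ P.1) ∧
    (∀ P Q x y, Occ T P (Nat.pair 0 x) → Occ T Q (Nat.pair 0 y) → Before P Q →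
      Before (f P) (f Q)) := by
  let f : ℕ × ℕ → ℕ × ℕ := fun P =>
    (σ P.1, match U[σ P.1]? with | some (.live _) => liveRank bot (β P.1) | _ => P.2)
  refine ⟨f, fun P x hP => ⟨?_, rfl⟩, fun P Q x y hP hQ hPQ => ?_⟩
  · rcases h.occ_sub P x hP with ⟨D, hD, hx, -⟩ | ⟨M, D, hM, hD, hx, -⟩
    · exact ⟨.dead D, hD, by simpa only [f, hD, Block.symbols] using hx⟩
    · exact ⟨.live M, hM, by simpa only [f, hM, Block.symbols] using hx⟩
  · rcases (h.le hQ hPQ).eq_or_lt with hs | hs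
    · right
      refine ⟨hs, ?_⟩
      rcases h.occ_sub P x hP with ⟨D, hD, hx, h0⟩ | ⟨M, D, hM, hD, hx, h0⟩
      · rcases h.occ_sub Q y hQ with ⟨D', hD', hy, h0'⟩ | ⟨M, D', hM, hD', hy, h0'⟩
        · simp only [f, hD, hD']
          rcases hPQ with hPQ | hPQ
          · have := h.mono _ _ hPQ hQ.lt_length
            omega
          · exact hPQ.2
        · rw [← hs, hD] at hM; cases hM
      · rcases h.occ_sub Q y hQ with ⟨D', hD', hy, h0'⟩ | ⟨M', D', hM', hD', hy, h0'⟩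
        · rw [← hs, hM] at hD'; cases hD'
        · simp only [f, hM, hM']
          refine liveRank_lt hD ?_
          rcases hPQ with hPQ | hPQ
          · have := h.mono _ _ hPQ hQ.lt_length
            omega
          · omega
    · exact .inl hs

/-- A symbol of `U` is inserted only once in each copy of `bot`. -/
theorem not_before_of_eq (h : ShuffleIndex T U bot σ β e) (hU : NodupBlocks U) {P Q : ℕ × ℕ}
    {x : ℕ} (hP : Occ T P (Nat.pair 0 x)) (hQ : Occ T Q (Nat.pair 0 x)) (hs : σ P.1 = σ Q.1) :
    ¬ Before P Q := by
  intro hPQ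
  obtain ⟨f, hf1, hf2⟩ := h.exists_subPos
  obtain ⟨hP1, hP2⟩ := hf1 P x hP
  obtain ⟨hQ1, hQ2⟩ := hf1 Q x hQ
  exact (hf2 P Q x x hP hQ hPQ).ne (hP1.eq_of_fst_eq hU hQ1 (by omega))

/-- The copy of `bot` is determined by any of its symbols. -/
theorem eq_of_occ_bot (h : ShuffleIndex T U bot σ β e) {P Q : ℕ × ℕ} {q y y' : ℕ}
    (hP : Occ T P (Nat.pair (q + 1) y)) (hQ : Occ T Q (Nat.pair (q + 1) y')) :
    σ P.1 = σ Q.1 := by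
  obtain ⟨h1, ⟨M, hM⟩, -⟩ := h.occ_bot P q y hP
  obtain ⟨h2, ⟨M', hM'⟩, -⟩ := h.occ_bot Q q y' hQ
  exact liveRank_inj hM hM' (h1.symm.trans h2)

theorem before_bot (h : ShuffleIndex T U bot σ β e) {P Q : ℕ × ℕ} {q y q' y' : ℕ}
    (hP : Occ T P (Nat.pair (q + 1) y)) (hQ : Occ T Q (Nat.pair (q' + 1) y'))
    (hPQ : Before P Q) (hs : σ P.1 = σ Q.1) :
    Before (β P.1, P.2 - e P.1) (β Q.1, Q.2 - e Q.1) := by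
  have h1 := (h.occ_bot P q y hP).2.2.1
  rcases hPQ with hPQ | ⟨hPQ, h2⟩
  · rcases h.mono _ _ hPQ hQ.lt_length with h' | ⟨-, h'⟩
    · omega
    · exact .inl h'
  · refine .inr ⟨by simp [hPQ], ?_⟩
    rw [← hPQ]
    simp only
    omega

theorem le_of_mem_live (h : ShuffleIndex T U bot σ β e) (hf : FirstLive U) {P Q : ℕ × ℕ}
    {x : ℕ} (hP : Occ T P (Nat.pair 0 x)) (hQ : Occ T Q (Nat.pair 0 x)) {M : List ℕ}
    (hM : U[σ P.1]? = some (.live M)) : σ P.1 ≤ σ Q.1 := by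
  obtain ⟨f, hf1, -⟩ := h.exists_subPos
  obtain ⟨hP1, hP2⟩ := hf1 P x hP
  obtain ⟨hQ1, hQ2⟩ := hf1 Q x hQ
  rw [← hQ2]
  exact hf _ M x _ hM (hP1.mem_live (hP2 ▸ hM)) hQ1

end ShuffleIndex

theorem exists_pair (x : ℕ) : (∃ y, x = Nat.pair 0 y) ∨ ∃ q y, x = Nat.pair (q + 1) y := by
  rw [← Nat.pair_unpair x]
  cases x.unpair.1 with
  | zero => exact .inl ⟨_, rfl⟩
  | succ q => exact .inr ⟨_, _, rfl⟩

/-- A shuffle avoids the comb if `bot` avoids it, if `U` avoids it strictly, and if no live block of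
`U` is followed by the teeth. -/
theorem ShuffleIndex.combFree {T U bot : BlockSeq} {σ β e : ℕ → ℕ} {k : ℕ} (hk : 1 ≤ k)
    (h : ShuffleIndex T U bot σ β e) (hn : NodupBlocks U) (hf : FirstLive U)
    (hbot : CombFree bot k) (hU : ∀ a z p q r, ¬ CombAt U k Before a z p q r)
    (hteeth : ∀ {b s t x z : ℕ} {M : List ℕ}, U[b]? = some (.live M) → M[s]? = some x →
      M[t]? = some z → s < t → ∀ {R₀ Q₀ R₁ : ℕ × ℕ}, b < R₀.1 → Occ U R₀ z → Occ U Q₀ x →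
      Occ U R₁ z → Before R₀ Q₀ → Before Q₀ R₁ →
      (2 ≤ k → ∃ y ∈ M, y ≠ z ∧ ∃ Q₁ R₂, Occ U Q₁ y ∧ Occ U R₂ z ∧ Before R₁ Q₁ ∧ Before Q₁ R₂) →
      x ≠ z → False) : CombFree T k := by
  intro a z p q r hc
  have hweak : ∀ P Q, WeakBefore T P Q → P.1 ≤ Q.1 := by
    rintro P Q (h | h)
    · exact h.fst_le
    · exact h.1.le
  rcases exists_pair z with ⟨z, rfl⟩ | ⟨c, z, rfl⟩
  · -- The symbol of the teeth comes from `U`.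
    have hsub : ∀ i ≤ k, 1 ≤ i → ∃ y, a i = Nat.pair 0 y := by
      intro i hi h1
      rcases exists_pair (a i) with hy | ⟨c, y, hy⟩
      · exact hy
      · have o1 := hc.p_occ i hi
        have o2 := hc.q_occ i hi
        rw [hy] at o1 o2
        have hs := h.eq_of_occ_bot o1 o2
        have l1 := h.le (hc.r_occ 0 (by omega)) (hc.p_r i hi)
        have l2 := h.le (hc.r_occ 1 (by omega)) (hc.r_before one_pos (by omega))
        have l3 := h.le o2 (hc.r_before_q h1 hi)
        exact (h.not_before_of_eq hn (hc.r_occ 0 (by omega)) (hc.r_occ 1 (by omega))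
          (by omega) (hc.r_before one_pos (by omega))).elim
    rcases exists_pair (a 0) with ⟨y, hy⟩ | ⟨c, y, hy⟩
    · -- All symbols come from `U`, so the comb is one of `U`.
      have hsub' : ∀ i, ∃ y, i ≤ k → a i = Nat.pair 0 y := by
        intro i
        by_cases hi : i ≤ k
        · rcases Nat.eq_zero_or_pos i with rfl | h0
          · exact ⟨y, fun _ => hy⟩
          · obtain ⟨y, hy⟩ := hsub i hi h0
            exact ⟨y, fun _ => hy⟩
        · exact ⟨0, fun h => (hi h).elim⟩
      choose a' ha' using hsub'
      obtain ⟨f, hf1, hf2⟩ := h.exists_subPos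
      have po : ∀ i ≤ k, Occ T (p i) (Nat.pair 0 (a' i)) := fun i hi => ha' i hi ▸ hc.p_occ i hi
      have qo : ∀ i ≤ k, Occ T (q i) (Nat.pair 0 (a' i)) := fun i hi => ha' i hi ▸ hc.q_occ i hi
      refine hU a' z (f ∘ p) (f ∘ q) (f ∘ r) ⟨fun i hi he => hc.ne i hi (by rw [ha' i hi, he]),
        fun i hi he => hc.a_ne i hi (by rw [ha' i hi.le, ha' (i + 1) hi, he]),
        fun i hi => (hf1 _ _ (po i hi)).1, fun i hi => (hf1 _ _ (qo i hi)).1,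
        fun i hi => (hf1 _ _ (hc.r_occ i hi)).1,
        fun i hi => hf2 _ _ _ _ (po i hi.le) (po (i + 1) hi) ?_,
        fun i hi => hf2 _ _ _ _ (po i hi) (hc.r_occ 0 (by omega)) (hc.p_r i hi),
        fun i hi => hf2 _ _ _ _ (hc.r_occ i (by omega)) (qo i hi) (hc.r_q i hi),
        fun i hi => hf2 _ _ _ _ (qo i hi) (hc.r_occ (i + 1) (by omega)) (hc.q_r i hi)⟩
      rcases hc.p_p i hi with hb | ⟨he, M, hM⟩
      · exact hb
      · -- A live block contains a single symbol of `U`, the first one.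
        exfalso
        have zero : ∀ j ≤ k, (p j).1 = (p i).1 → (p j).2 = 0 := by
          intro j hj hje
          rcases h.occ_sub _ _ (po j hj) with ⟨D, hD, -⟩ | ⟨-, -, -, -, -, h0⟩
          · obtain ⟨M', D', x, hM', -⟩ := h.live _ _ hM
            rw [hje, hM'] at hD; cases hD
          · exact h0
        have hpe : p i = p (i + 1) :=
          Prod.ext he ((zero i hi.le rfl).trans (zero (i + 1) hi he.symm).symm)
        have := hc.p_occ (i + 1) hi
        rw [← hpe] at this
        exact hc.a_ne i hi ((hc.p_occ i hi.le).unique this)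
    · -- Only `a 0` comes from a copy of `bot`, into which `a 1, …, a k, z` have been inserted.
      have o1 := hc.p_occ 0 (by omega)
      have o2 := hc.q_occ 0 (by omega)
      rw [hy] at o1 o2
      have hs := h.eq_of_occ_bot o1 o2
      obtain ⟨-, ⟨M, hM⟩, -⟩ := h.occ_bot _ _ _ o1
      have l1 := h.le (hc.r_occ 0 (by omega)) (hc.p_r 0 (by omega))
      have l2 := h.le o2 (hc.r_q 0 (by omega))
      have hp : ∀ i ≤ k, σ (p i).1 = σ (p 0).1 := fun i hi => le_antisymm
        ((h.le (hc.r_occ 0 (by omega)) (hc.p_r i hi)).trans (by omega))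
        (h.mono.le (hc.p_fst_le hweak (Nat.zero_le i) hi) (hc.p_occ i hi).lt_length)
      obtain ⟨f, hf1, hf2⟩ := h.exists_subPos
      have mem : ∀ {P x}, Occ T P (Nat.pair 0 x) → σ P.1 = σ (p 0).1 →
          M[(f P).2]? = some x := by
        intro P x hP he
        obtain ⟨⟨B, hB, hx⟩, h2⟩ := hf1 P x hP
        rw [h2, he, hM, Option.some.injEq] at hB
        subst hB
        exact hx
      have occ : ∀ i ≤ k, 1 ≤ i → ∃ y, a i = Nat.pair 0 y ∧ Occ T (p i) (Nat.pair 0 y) ∧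
          Occ T (q i) (Nat.pair 0 y) := by
        intro i hi h1
        obtain ⟨y, hy⟩ := hsub i hi h1
        exact ⟨y, hy, hy ▸ hc.p_occ i hi, hy ▸ hc.q_occ i hi⟩
      obtain ⟨x, hx, op, oq⟩ := occ 1 hk le_rfl
      have or' := hc.r_occ
      have or0 := or' 0 (by omega)
      have hr0 : σ (r 0).1 = σ (p 0).1 := by omega
      have hr1 : σ (p 0).1 < σ (r 1).1 := by
        have hb := hc.r_before one_pos (by omega)
        refine lt_of_le_of_ne ?_ fun he =>
          h.not_before_of_eq hn or0 (or' 1 (by omega)) (by omega) hb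
        have := h.le (or' 1 (by omega)) hb
        omega
      refine hteeth (b := σ (p 0).1) (R₀ := f (r 1)) (Q₀ := f (q 1)) (R₁ := f (r 2)) hM
        (mem op (hp 1 hk)) (mem or0 hr0) ?_ ?_ (hf1 _ _ (or' 1 (by omega))).1
        (hf1 _ _ oq).1 (hf1 _ _ (or' 2 (by omega))).1
        (hf2 _ _ _ _ (or' 1 (by omega)) oq (hc.r_q 1 hk))
        (hf2 _ _ _ _ oq (or' 2 (by omega)) (hc.q_r 1 hk)) (fun hk2 => ?_)
        (fun he => hc.ne 1 hk (by rw [hx, he]))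
      · have hb := hf2 _ _ _ _ op or0 (hc.p_r 1 hk)
        have e1 := (hf1 _ _ op).2
        have e2 := (hf1 _ _ or0).2
        have := hp 1 hk
        unfold Before at hb
        omega
      · rw [(hf1 _ _ (or' 1 (by omega))).2]
        exact hr1
      · obtain ⟨y, hy, op2, oq2⟩ := occ 2 hk2 (by omega)
        exact ⟨y, List.mem_of_getElem? (mem op2 (hp 2 hk2)),
          fun he => hc.ne 2 hk2 (by rw [hy, he]), f (q 2), f (r 3),
          (hf1 _ _ oq2).1, (hf1 _ _ (or' 3 (by omega))).1,
          hf2 _ _ _ _ (or' 2 (by omega)) oq2 (hc.r_q 2 hk2),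
          hf2 _ _ _ _ oq2 (or' 3 (by omega)) (hc.q_r 2 hk2)⟩
  · -- The symbol of the teeth comes from a copy of `bot`, and so does the whole comb.
    have hr : ∀ i ≤ k + 1, σ (r i).1 = σ (r 0).1 := fun i hi =>
      h.eq_of_occ_bot (hc.r_occ i hi) (hc.r_occ 0 (by omega))
    have hq : ∀ i ≤ k, σ (q i).1 = σ (r 0).1 := by
      intro i hi
      have l1 := h.le (hc.q_occ i hi) (hc.r_q i hi)
      have l2 := h.le (hc.r_occ (i + 1) (by omega)) (hc.q_r i hi)
      have := hr i (by omega)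
      have := hr (i + 1) (by omega)
      omega
    obtain ⟨hcr, ⟨M, hM⟩, -⟩ := h.occ_bot _ _ _ (hc.r_occ 0 (by omega))
    have hbot' : ∀ i ≤ k, ∃ y, a i = Nat.pair (c + 1) y := by
      intro i hi
      have op := hc.p_occ i hi
      have oq := hc.q_occ i hi
      rcases exists_pair (a i) with ⟨y, hy⟩ | ⟨c', y, hy⟩
      · rw [hy] at op oq
        have l1 := h.le_of_mem_live hf oq op (hq i hi ▸ hM)
        have hb := hc.p_before_q hi hi
        have l2 := h.le oq hb
        exact (h.not_before_of_eq hn op oq (by omega) hb).elim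
      · rw [hy] at oq
        have := (h.occ_bot _ _ _ oq).1
        rw [hq i hi, ← hcr] at this
        exact ⟨y, by rw [hy, this]⟩
    have hbot'' : ∀ i, ∃ y, i ≤ k → a i = Nat.pair (c + 1) y := by
      intro i
      by_cases hi : i ≤ k
      · obtain ⟨y, hy⟩ := hbot' i hi
        exact ⟨y, fun _ => hy⟩
      · exact ⟨0, fun h => (hi h).elim⟩
    choose a' ha' using hbot''
    have po : ∀ i ≤ k, Occ T (p i) (Nat.pair (c + 1) (a' i)) := fun i hi =>
      ha' i hi ▸ hc.p_occ i hi
    have qo : ∀ i ≤ k, Occ T (q i) (Nat.pair (c + 1) (a' i)) := fun i hi =>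
      ha' i hi ▸ hc.q_occ i hi
    have hp : ∀ i ≤ k, σ (p i).1 = σ (r 0).1 := fun i hi =>
      h.eq_of_occ_bot (po i hi) (hc.r_occ 0 (by omega))
    let g : ℕ × ℕ → ℕ × ℕ := fun P => (β P.1, P.2 - e P.1)
    have ob : ∀ {P y}, Occ T P (Nat.pair (c + 1) y) → Occ bot (g P) y := fun hP =>
      (h.occ_bot _ _ _ hP).2.2.2
    refine hbot a' z (g ∘ p) (g ∘ q) (g ∘ r) ⟨fun i hi he => hc.ne i hi (by rw [ha' i hi, he]),
      fun i hi he => hc.a_ne i hi (by rw [ha' i hi.le, ha' (i + 1) hi, he]),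
      fun i hi => ob (po i hi), fun i hi => ob (qo i hi), fun i hi => ob (hc.r_occ i hi),
      fun i hi => ?_,
      fun i hi => h.before_bot (po i hi) (hc.r_occ 0 (by omega)) (hc.p_r i hi) (hp i hi),
      fun i hi => h.before_bot (hc.r_occ i (by omega)) (qo i hi) (hc.r_q i hi)
        ((hr i (by omega)).trans (hq i hi).symm),
      fun i hi => h.before_bot (qo i hi) (hc.r_occ (i + 1) (by omega)) (hc.q_r i hi)
        ((hq i hi).trans (hr (i + 1) (by omega)).symm)⟩
    rcases hc.p_p i hi with hb | ⟨he, B, hB⟩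
    · exact .inl (h.before_bot (po i hi.le) (po (i + 1) hi) hb
        ((hp i hi.le).trans (hp (i + 1) hi).symm))
    · obtain ⟨-, D, -, -, hD, -⟩ := h.live _ _ hB
      exact .inr ⟨congrArg β he, D, hD⟩

/-! ### Invariance under composition, shuffling and renaming -/

/-- The basic invariants: blocks have distinct symbols, live blocks have length `j`, and every
symbol occurs in exactly one live block, which precedes its other occurrences. -/
structure Basic (j : ℕ) (T : BlockSeq) : Prop where
  nodup : NodupBlocks T
  live_length : ∀ M, .live M ∈ T → M.length = j
  first : FirstLive T
  cover : ∀ x ∈ symbols T, ∃ M, .live M ∈ T ∧ x ∈ M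

/-- The alphabet of `T` is an initial segment of `ℕ`. -/
def IsCanonical (T : BlockSeq) : Prop := ∀ x ∈ symbols T, x < alphabetSize (symbols T)

theorem IsCanonical.mem_of_lt {T : BlockSeq} (h : IsCanonical T) {x : ℕ}
    (hx : x < alphabetSize (symbols T)) : x ∈ symbols T := by
  have hsub : (symbols T).toFinset ⊆ Finset.range (alphabetSize (symbols T)) := fun y hy =>
    Finset.mem_range.2 (h y (List.mem_toFinset.1 hy))
  have := Finset.eq_of_subset_of_card_le hsub (by rw [Finset.card_range]; rfl)
  rw [← List.mem_toFinset, this]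
  exact Finset.mem_range.2 hx

theorem getD_injOn {M : List ℕ} (hM : M.Nodup) :
    Set.InjOn (fun x => M.getD x 0) {x | x < M.length} := by
  intro x hx y hy hxy
  simp only [Set.mem_ofPred_eq] at hx hy
  simpa [hx, hy, hM.getElem_inj_iff] using hxy

theorem mem_symbols {T : BlockSeq} {x : ℕ} : x ∈ symbols T ↔ ∃ B ∈ T, x ∈ B.symbols :=
  List.mem_flatMap

theorem symbols_blockRename (f : ℕ → ℕ) (B : Block) : (B.rename f).symbols = B.symbols.map f := by
  cases B <;> rfl

theorem symbols_rename (f : ℕ → ℕ) (T : BlockSeq) : symbols (T.rename f) = (symbols T).map f := by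
  induction T with
  | nil => rfl
  | cons B T ih =>
    simp only [symbols, rename, List.map_cons, List.flatMap_cons, List.map_append,
      symbols_blockRename] at ih ⊢
    rw [ih]

theorem mem_compose_of_live {top mid : BlockSeq} {M : List ℕ} (hM : .live M ∈ top) {E : Block}
    (hE : E ∈ mid) : E.rename (fun x => M.getD x 0) ∈ compose top mid :=
  List.mem_flatMap.2 ⟨_, hM, List.mem_map_of_mem hE⟩

theorem Basic.compose {top mid : BlockSeq} {l : ℕ}
    (ht : Basic (alphabetSize (symbols mid)) top) (hm : Basic l mid) (hc : IsCanonical mid) :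
    Basic l (compose top mid) := by
  have hlt : ∀ M x, .live M ∈ top → x ∈ symbols mid → x < M.length := fun M x hM hx => by
    rw [ht.live_length M hM]
    exact hc x hx
  refine ⟨?_, ?_, ?_, ?_⟩
  · intro B hB
    obtain ⟨E, hE, hB⟩ := List.mem_flatMap.1 hB
    cases E with
    | dead D =>
      simp only [List.mem_singleton] at hB
      subst hB
      exact ht.nodup _ hE
    | live M =>
      obtain ⟨E, hE', rfl⟩ := List.mem_map.1 hB
      rw [symbols_blockRename]
      refine (hm.nodup E hE').map_on fun x hx y hy hxy => getD_injOn (ht.nodup _ hE) ?_ ?_ hxy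
      · exact hlt M x hE (mem_symbols.2 ⟨E, hE', hx⟩)
      · exact hlt M y hE (mem_symbols.2 ⟨E, hE', hy⟩)
  · intro B hB
    obtain ⟨E, hE, hB⟩ := List.mem_flatMap.1 hB
    cases E with
    | dead D => simp at hB
    | live M =>
      obtain ⟨E, hE', hB⟩ := List.mem_map.1 hB
      cases E with
      | dead D => simp [Block.rename] at hB
      | live D =>
        simp only [Block.rename, Block.live.injEq] at hB
        rw [← hB, List.length_map]
        exact hm.live_length D hE'
  · obtain ⟨σ, β, h⟩ := exists_composeIndex hlt
    intro b B x P hB hx hP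
    by_contra! hlt
    obtain ⟨M, E, hM, hE, hME⟩ := h.live b B hB
    have hnM : M.Nodup := ht.nodup _ (List.mem_of_getElem? hM)
    obtain ⟨t, ht'⟩ := List.mem_iff_getElem?.1 hx
    obtain ⟨y, hy, hyM⟩ := hME t x ht'
    have hb : b < (GenDS.BlockSeq.compose top mid).length := (List.getElem?_eq_some_iff.1 hB).1
    obtain ⟨u, hu⟩ := h.occ_top hP
    have h1 := ht.first _ M x _ hM (List.mem_of_getElem? hyM) hu
    simp only at h1
    rcases h.mono _ _ hlt hb with h2 | ⟨h2, h3⟩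
    · omega
    · have h4 := h.occ_mid ht.nodup hP (h2 ▸ hM)
      obtain ⟨hyl, rfl⟩ := List.getElem?_eq_some_iff.1 hyM
      rw [hnM.idxOf_getElem] at h4
      have := hm.first _ E y _ hE (List.mem_of_getElem? hy) h4
      simp only at this
      omega
  · -- Symbols of live blocks of `top` reach live blocks, as `mid` has the whole alphabet.
    have key : ∀ M, .live M ∈ top → ∀ t ∈ symbols mid,
        ∃ B, .live B ∈ GenDS.BlockSeq.compose top mid ∧ M.getD t 0 ∈ B := by
      intro M hM t ht
      obtain ⟨E, hE, htE⟩ := hm.cover t ht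
      exact ⟨_, mem_compose_of_live hM hE, List.mem_map_of_mem htE⟩
    intro x hx
    obtain ⟨B, hB, hx⟩ := mem_symbols.1 hx
    obtain ⟨E, hE, hB⟩ := List.mem_flatMap.1 hB
    cases E with
    | dead D =>
      simp only [List.mem_singleton] at hB
      subst hB
      obtain ⟨M, hM, hxM⟩ := ht.cover x (mem_symbols.2 ⟨_, hE, hx⟩)
      obtain ⟨t, htl, rfl⟩ := List.mem_iff_getElem.1 hxM
      have := key M hM t (hc.mem_of_lt (by rw [← ht.live_length M hM]; exact htl))
      simpa [htl] using this
    | live M =>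
      obtain ⟨E, hE', rfl⟩ := List.mem_map.1 hB
      rw [symbols_blockRename] at hx
      obtain ⟨t, ht, rfl⟩ := List.mem_map.1 hx
      exact key M hE t (mem_symbols.2 ⟨E, hE', ht⟩)

theorem exists_mem_insertLive (as : List ℕ) (T : BlockSeq) (h : as.length = numLive T) :
    (∀ D, .live D ∈ T → ∃ x, .live (x :: D) ∈ insertLive true as T) ∧
      ∀ x ∈ as, ∃ D, .live (x :: D) ∈ insertLive true as T := by
  induction T generalizing as with
  | nil => simp_all
  | cons B T ih =>
    cases B with
    | dead D =>
      have := ih as (by simpa using h)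
      simpa [insertLive] using this
    | live D =>
      cases as with
      | nil => simp at h
      | cons a as =>
        obtain ⟨h1, h2⟩ := ih as (by simpa using h)
        simp only [insertLive, if_true]
        refine ⟨fun D' hD' => ?_, fun x hx => ?_⟩
        · rcases List.mem_cons.1 hD' with hD' | hD'
          · cases hD'
            exact ⟨a, List.mem_cons_self⟩
          · obtain ⟨x, hx⟩ := h1 D' hD'
            exact ⟨x, List.mem_cons_of_mem _ hx⟩
        · rcases List.mem_cons.1 hx with rfl | hx
          · exact ⟨D, List.mem_cons_self⟩
          · obtain ⟨D', hD'⟩ := h2 x hx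
            exact ⟨D', List.mem_cons_of_mem _ hD'⟩

theorem exists_mem_shuffleSegments (bot : BlockSeq) (q : ℕ) (U : BlockSeq) {M : List ℕ}
    (hM : .live M ∈ U) : ∃ c, insertLive true (M.map (Nat.pair 0)) (bot.rename (Nat.pair (c + 1))) ∈
      shuffleSegments bot q U := by
  induction U generalizing q with
  | nil => simp at hM
  | cons B U ih =>
    cases B with
    | dead D =>
      obtain ⟨c, hc⟩ := ih q (by simpa using hM)
      exact ⟨c, List.mem_cons_of_mem _ hc⟩
    | live D =>
      rcases List.mem_cons.1 hM with hM | hM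
      · cases hM
        exact ⟨q, List.mem_cons_self⟩
      · obtain ⟨c, hc⟩ := ih (q + 1) hM
        exact ⟨c, List.mem_cons_of_mem _ hc⟩

theorem nodup_map_pair {D : List ℕ} (c : ℕ) (h : D.Nodup) : (D.map (Nat.pair c)).Nodup :=
  h.map fun _ _ hxy => (Nat.pair_eq_pair.1 hxy).2

theorem Basic.shuffleFrom {U bot : BlockSeq} {j : ℕ} (hU : Basic bot.numLive U)
    (hb : Basic j bot) : Basic (j + 1) (shuffleFrom true bot 0 U) := by
  refine ⟨?_, ?_, ?_, ?_⟩
  · obtain ⟨σ, β, h, -⟩ := exists_shuffle_index U bot hU.live_length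
    intro B hB
    obtain ⟨b, hB⟩ := List.mem_iff_getElem?.1 hB
    rcases h b B hB with ⟨D, hD, rfl, -⟩ | ⟨M, D, hM, hD, rfl⟩ | ⟨M, D, x, hM, hD, hx, rfl⟩
    · exact nodup_map_pair 0 (hU.nodup _ (List.mem_of_getElem? hD))
    · exact nodup_map_pair _ (hb.nodup _ (List.mem_of_getElem? hD))
    · refine List.nodup_cons.2 ⟨fun hmem => ?_,
        nodup_map_pair _ (hb.nodup _ (List.mem_of_getElem? hD))⟩
      obtain ⟨y, -, hy⟩ := List.mem_map.1 hmem
      simp [Nat.pair_eq_pair] at hy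
  · obtain ⟨σ, β, h, -⟩ := exists_shuffle_index U bot hU.live_length
    intro B hB
    obtain ⟨b, hB⟩ := List.mem_iff_getElem?.1 hB
    rcases h b _ hB with ⟨D, hD, h, -⟩ | ⟨M, D, hM, hD, h⟩ | ⟨M, D, x, hM, hD, hx, h⟩
    · cases h
    · cases h
    · cases h
      simp [hb.live_length D (List.mem_of_getElem? hD)]
  · obtain ⟨σ, β, e, h⟩ := exists_shuffleIndex hU.live_length
    intro b B x P hB hx hP
    by_contra! hlt
    obtain ⟨M, D, x', hM, hD, hx', rfl⟩ := h.live b B hB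
    have hl : b < (GenDS.BlockSeq.shuffleFrom true bot 0 U).length :=
      (List.getElem?_eq_some_iff.1 hB).1
    rcases List.mem_cons.1 hx with rfl | hx
    · have hQ : Occ (GenDS.BlockSeq.shuffleFrom true bot 0 U) (b, 0) (Nat.pair 0 x') :=
        ⟨_, hB, rfl⟩
      have h1 := h.le_of_mem_live hU.first hQ hP hM
      have hPQ : Before P (b, 0) := .inl hlt
      have h2 := h.le hQ hPQ
      exact h.not_before_of_eq hU.nodup hP hQ (le_antisymm h2 h1) hPQ
    · obtain ⟨y, hy, rfl⟩ := List.mem_map.1 hx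
      obtain ⟨h1, ⟨M', hM'⟩, -, h2⟩ := h.occ_bot _ _ _ hP
      have hs := liveRank_inj hM hM' h1
      have := hb.first _ D y _ hD hy h2
      simp only at this
      have := h.mono _ _ hlt hl
      omega
  · have key : ∀ M, .live M ∈ U → ∀ x ∈ M,
        ∃ B, .live B ∈ GenDS.BlockSeq.shuffleFrom true bot 0 U ∧ Nat.pair 0 x ∈ B := by
      intro M hM x hx
      obtain ⟨c, hc⟩ := exists_mem_shuffleSegments bot 0 U hM
      obtain ⟨D, hD⟩ := (exists_mem_insertLive (M.map (Nat.pair 0)) (bot.rename (Nat.pair (c + 1)))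
        (by rw [List.length_map, numLive_rename, hU.live_length M hM])).2 _
        (List.mem_map_of_mem hx)
      refine ⟨Nat.pair 0 x :: D, ?_, List.mem_cons_self⟩
      rw [← flatten_shuffleSegments]
      exact List.mem_flatten.2 ⟨_, hc, hD⟩
    intro x hx
    obtain ⟨B, hB, hx⟩ := mem_symbols.1 hx
    have hB' := hB
    rw [← flatten_shuffleSegments] at hB'
    obtain ⟨S, hS, hBS⟩ := List.mem_flatten.1 hB'
    obtain ⟨s, hs⟩ := List.mem_iff_getElem?.1 hS
    rcases shuffleSegments_getElem? bot 0 U s S hs with ⟨D, hD, rfl⟩ | ⟨M, hM, rfl⟩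
    · simp only [List.mem_singleton] at hBS
      subst hBS
      obtain ⟨y, hy, rfl⟩ := List.mem_map.1 hx
      obtain ⟨M, hM, hyM⟩ := hU.cover y (mem_symbols.2 ⟨_, List.mem_of_getElem? hD, hy⟩)
      exact key M hM y hyM
    · have hlen : (M.map (Nat.pair 0)).length =
          numLive (bot.rename (Nat.pair (0 + liveRank U s + 1))) := by
        rw [List.length_map, numLive_rename, hU.live_length M (List.mem_of_getElem? hM)]
      have hbot : ∀ D ∈ bot, ∀ y ∈ D.symbols, ∃ B,
          .live B ∈ GenDS.BlockSeq.shuffleFrom true bot 0 U ∧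
            Nat.pair (0 + liveRank U s + 1) y ∈ B := by
        intro D hD y hy
        obtain ⟨E, hE, hyE⟩ := hb.cover y (mem_symbols.2 ⟨D, hD, hy⟩)
        obtain ⟨x, hx⟩ := (exists_mem_insertLive _ _ hlen).1
          (E.map (Nat.pair (0 + liveRank U s + 1))) (List.mem_map.2 ⟨_, hE, rfl⟩)
        refine ⟨_, ?_, List.mem_cons_of_mem x (List.mem_map_of_mem hyE)⟩
        rw [← flatten_shuffleSegments]
        exact List.mem_flatten.2 ⟨_, hS, hx⟩
      obtain ⟨b, hb'⟩ := List.mem_iff_getElem?.1 hBS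
      rcases insertLive_getElem? _ _ hlen b B hb' with ⟨D, hD, rfl⟩ | ⟨D, x', hD, hx', rfl⟩
      · obtain ⟨E, hE, hEr⟩ := List.mem_map.1 (List.mem_of_getElem? hD)
        have : x ∈ (E.rename (Nat.pair (0 + liveRank U s + 1))).symbols := by rw [hEr]; exact hx
        rw [symbols_blockRename] at this
        obtain ⟨y, hy, rfl⟩ := List.mem_map.1 this
        exact hbot E hE y hy
      · rcases List.mem_cons.1 hx with rfl | hx
        · obtain ⟨y, hy, rfl⟩ := List.mem_map.1 (List.mem_of_getElem? hx')
          exact key M (List.mem_of_getElem? hM) y hy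
        · obtain ⟨E, hE, hEr⟩ := List.mem_map.1 (List.mem_of_getElem? hD)
          have : x ∈ (E.rename (Nat.pair (0 + liveRank U s + 1))).symbols := by
            rw [hEr]; exact hx
          rw [symbols_blockRename] at this
          obtain ⟨y, hy, rfl⟩ := List.mem_map.1 this
          exact hbot E hE y hy

/-- After a live block of a preshuffle the symbols of `bot` in it return inside the copy of `bot`,
and the symbol of `U`, which is the first one of the block, only after this copy. -/
theorem ShuffleIndex.reversing {T U bot : BlockSeq} {σ β e : ℕ → ℕ}
    (h : ShuffleIndex T U bot σ β e) (hn : NodupBlocks U) (hb : Reversing bot) :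
    Reversing T := by
  intro b B s t x y P Q hB hst hs ht hP hQ hbP hbQ hPQ
  obtain ⟨M, D, x', hM, hD, hx', rfl⟩ := h.live b B hB
  obtain ⟨t, rfl⟩ : ∃ t', t = t' + 1 := ⟨t - 1, by omega⟩
  rw [List.getElem?_cons_succ, List.getElem?_map, Option.map_eq_some_iff] at ht
  obtain ⟨y, hy, rfl⟩ := ht
  have hyb : Occ T (b, t + 1) (Nat.pair (liveRank U (σ b) + 1) y) :=
    ⟨_, hB, by simp [Block.symbols, hy]⟩
  have hsQ := h.eq_of_occ_bot hyb hQ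
  simp only at hsQ
  have l1 := h.mono.le hbP.le hP.lt_length
  have l2 := h.le hQ hPQ
  cases s with
  | zero =>
    simp only [List.getElem?_cons_zero, Option.some.injEq] at hs
    subst hs
    exact h.not_before_of_eq hn (P := (b, 0)) ⟨_, hB, rfl⟩ hP (by simp only; omega) (.inl hbP)
  | succ s =>
    rw [List.getElem?_cons_succ, List.getElem?_map, Option.map_eq_some_iff] at hs
    obtain ⟨x, hx, rfl⟩ := hs
    have m1 := h.mono _ _ hbP hP.lt_length
    have m2 := h.mono _ _ hbQ hQ.lt_length
    exact hb (β b) D s t x y _ _ hD (by omega) hx hy (h.occ_bot _ _ _ hP).2.2.2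
      (h.occ_bot _ _ _ hQ).2.2.2 (by simp only; omega) (by simp only; omega)
      (h.before_bot hP hQ hPQ (by omega))

section Rename

variable {T : BlockSeq} {f : ℕ → ℕ}

theorem rename_getElem? {b : ℕ} {B : Block} :
    (T.rename f)[b]? = some B ↔ ∃ E, T[b]? = some E ∧ E.rename f = B := by
  rw [rename, List.getElem?_map, Option.map_eq_some_iff]

theorem occ_rename {P : ℕ × ℕ} {x : ℕ} :
    Occ (T.rename f) P x ↔ ∃ y, Occ T P y ∧ f y = x := by
  constructor
  · rintro ⟨B, hB, hx⟩
    obtain ⟨E, hE, rfl⟩ := rename_getElem?.1 hB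
    rw [symbols_blockRename, List.getElem?_map, Option.map_eq_some_iff] at hx
    obtain ⟨y, hy, rfl⟩ := hx
    exact ⟨y, ⟨E, hE, hy⟩, rfl⟩
  · rintro ⟨y, ⟨E, hE, hy⟩, rfl⟩
    exact ⟨_, rename_getElem?.2 ⟨E, hE, rfl⟩, by rw [symbols_blockRename]; simp [hy]⟩

theorem rename_eq_live {E : Block} {M : List ℕ} (h : E.rename f = .live M) :
    ∃ D, E = .live D ∧ M = D.map f := by
  cases E with
  | dead D => simp [Block.rename] at h
  | live D => exact ⟨D, rfl, by simpa [Block.rename, eq_comm] using h⟩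

theorem Basic.rename {j : ℕ} (h : Basic j T) (hf : Set.InjOn f {x | x ∈ symbols T}) :
    Basic j (T.rename f) := by
  have mem : ∀ {B x}, B ∈ T → x ∈ B.symbols → x ∈ symbols T := fun hB hx =>
    mem_symbols.2 ⟨_, hB, hx⟩
  refine ⟨?_, ?_, ?_, ?_⟩
  · intro B hB
    obtain ⟨E, hE, rfl⟩ := List.mem_map.1 hB
    rw [symbols_blockRename]
    exact (h.nodup E hE).map_on fun x hx y hy hxy => hf (mem hE hx) (mem hE hy) hxy
  · intro M hM
    obtain ⟨E, hE, hr⟩ := List.mem_map.1 hM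
    obtain ⟨D, rfl, rfl⟩ := rename_eq_live hr
    rw [List.length_map, h.live_length D hE]
  · intro b M x P hM hx hP
    obtain ⟨E, hE, hr⟩ := rename_getElem?.1 hM
    obtain ⟨D, rfl, rfl⟩ := rename_eq_live hr
    obtain ⟨y, hy, rfl⟩ := List.mem_map.1 hx
    obtain ⟨y', hP, hyy⟩ := occ_rename.1 hP
    rw [hf hP.mem (mem (List.mem_of_getElem? hE) hy) hyy] at hP
    exact h.first b D y P hE hy hP
  · intro x hx
    rw [symbols_rename] at hx
    obtain ⟨y, hy, rfl⟩ := List.mem_map.1 hx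
    obtain ⟨M, hM, hyM⟩ := h.cover y hy
    exact ⟨_, List.mem_map.2 ⟨_, hM, rfl⟩, List.mem_map_of_mem hyM⟩

theorem Reversing.rename (h : Reversing T) (hf : Set.InjOn f {x | x ∈ symbols T}) :
    Reversing (T.rename f) := by
  intro b M s t x y P Q hM hst hs ht hP hQ
  obtain ⟨E, hE, hr⟩ := rename_getElem?.1 hM
  obtain ⟨D, rfl, rfl⟩ := rename_eq_live hr
  rw [List.getElem?_map, Option.map_eq_some_iff] at hs ht
  obtain ⟨x, hs, rfl⟩ := hs
  obtain ⟨y, ht, rfl⟩ := ht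
  obtain ⟨x', hP, hxx⟩ := occ_rename.1 hP
  obtain ⟨y', hQ, hyy⟩ := occ_rename.1 hQ
  have ox : Occ T (b, s) x := ⟨_, hE, hs⟩
  have oy : Occ T (b, t) y := ⟨_, hE, ht⟩
  rw [hf hP.mem ox.mem hxx] at hP
  rw [hf hQ.mem oy.mem hyy] at hQ
  exact h b D s t x y P Q hE hst hs ht hP hQ

theorem CombFree.rename {k : ℕ} (h : CombFree T k) (hf : Set.InjOn f {x | x ∈ symbols T}) :
    CombFree (T.rename f) k := by
  intro a z p q r hc
  obtain ⟨z, oz, rfl⟩ := occ_rename.1 (hc.r_occ 0 (by omega))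
  have ha : ∀ i, ∃ y, i ≤ k → Occ T (p i) y ∧ f y = a i := by
    intro i
    by_cases hi : i ≤ k
    · obtain ⟨y, hy⟩ := occ_rename.1 (hc.p_occ i hi)
      exact ⟨y, fun _ => hy⟩
    · exact ⟨0, fun h => (hi h).elim⟩
  choose a' ha' using ha
  refine h a' z p q r ⟨fun i hi he => hc.ne i hi ?_, fun i hi he => hc.a_ne i hi ?_,
    fun i hi => (ha' i hi).1, fun i hi => ?_, fun i hi => ?_, fun i hi => ?_,
    hc.p_r, hc.r_q, hc.q_r⟩
  · rw [← (ha' i hi).2, he]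
  · rw [← (ha' i hi.le).2, ← (ha' (i + 1) hi).2, he]
  · obtain ⟨y, hy, he⟩ := occ_rename.1 (hc.q_occ i hi)
    rw [← (ha' i hi).2] at he
    rwa [hf hy.mem (ha' i hi).1.mem he] at hy
  · obtain ⟨y, hy, he⟩ := occ_rename.1 (hc.r_occ i hi)
    rwa [hf hy.mem oz.mem he] at hy
  · rcases hc.p_p i hi with hb | ⟨he, M, hM⟩
    · exact .inl hb
    · obtain ⟨E, hE, hr⟩ := rename_getElem?.1 hM
      obtain ⟨D, rfl, -⟩ := rename_eq_live hr
      exact .inr ⟨he, D, hE⟩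

end Rename

theorem mem_takeWhile_or {S : List ℕ} {x y : ℕ} (hx : x ∈ S) (hy : y ∈ S) (hxy : x ≠ y) :
    x ∈ S.takeWhile (· ≠ y) ∨ y ∈ S.takeWhile (· ≠ x) := by
  induction S with
  | nil => simp at hx
  | cons a S ih =>
    by_cases hax : a = x
    · subst hax
      left
      simp [hxy]
    · by_cases hay : a = y
      · subst hay
        right
        simp [hax]
      · have := ih (by simpa [Ne.symm hax] using hx) (by simpa [Ne.symm hay] using hy)
        simp only [List.takeWhile_cons, ne_eq, hax, hay, not_false_eq_true, decide_true, if_true,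
          List.mem_cons]
        exact this.imp .inr .inr

/-- Numbering the symbols of `S` by first appearance is injective, with values below `‖S‖`. -/
theorem injOn_firstAppearance (S : List ℕ) :
    Set.InjOn (fun x => (S.takeWhile (· ≠ x)).toFinset.card) {x | x ∈ S} ∧
      ∀ x ∈ S, (S.takeWhile (· ≠ x)).toFinset.card < S.toFinset.card := by
  have hsub : ∀ x ∈ S, insert x (S.takeWhile (· ≠ x)).toFinset ⊆ S.toFinset := by
    intro x hx y hy
    rcases Finset.mem_insert.1 hy with rfl | hy
    · exact List.mem_toFinset.2 hx
    · exact List.mem_toFinset.2 ((List.takeWhile_prefix _).subset (List.mem_toFinset.1 hy))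
  have hnot : ∀ x, x ∉ (S.takeWhile (· ≠ x)).toFinset := by
    intro x hx
    have := List.mem_takeWhile_imp (List.mem_toFinset.1 hx)
    simp at this
  have hlt : ∀ x y, x ∈ S.takeWhile (· ≠ y) →
      (S.takeWhile (· ≠ x)).toFinset.card < (S.takeWhile (· ≠ y)).toFinset.card := by
    intro x y hx
    refine Finset.card_lt_card ⟨fun u hu => ?_, fun hs => hnot x (hs (List.mem_toFinset.2 hx))⟩
    rw [List.mem_toFinset] at hu ⊢
    -- Both are prefixes of `S`; the one for `x` is the shorter one, as `x` is only in the other.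
    rcases List.prefix_or_prefix_of_prefix (List.takeWhile_prefix (· ≠ x) (l := S))
      (List.takeWhile_prefix (· ≠ y) (l := S)) with h | h
    · exact h.subset hu
    · exact (hnot x (List.mem_toFinset.2 (h.subset hx))).elim
  refine ⟨fun x hx y hy hxy => ?_, fun x hx => ?_⟩
  · by_contra hne
    rcases mem_takeWhile_or hx hy hne with h | h
    · exact (hlt x y h).ne hxy
    · exact (hlt y x h).ne hxy.symm
  · have := Finset.card_le_card (hsub x hx)
    rw [Finset.card_insert_of_notMem (hnot x)] at this
    omega

theorem injOn_canonical (T : BlockSeq) :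
    Set.InjOn (fun x => ((symbols T).takeWhile (· ≠ x)).toFinset.card) {x | x ∈ symbols T} :=
  (injOn_firstAppearance _).1

theorem alphabetSize_map {S : List ℕ} {f : ℕ → ℕ} (hf : Set.InjOn f {x | x ∈ S}) :
    alphabetSize (S.map f) = alphabetSize S := by
  unfold alphabetSize
  have : (S.map f).toFinset = S.toFinset.image f := by ext; simp
  rw [this, Finset.card_image_of_injOn]
  intro x hx y hy
  exact hf (by simpa using hx) (by simpa using hy)

theorem isCanonical_canonical (T : BlockSeq) : IsCanonical T.canonical := by
  intro x hx
  unfold canonical at hx ⊢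
  rw [symbols_rename, alphabetSize_map (injOn_canonical T)]
  rw [symbols_rename] at hx
  obtain ⟨y, hy, rfl⟩ := List.mem_map.1 hx
  exact (injOn_firstAppearance _).2 y hy

/-! ### The recursive construction -/

/-- The blocked sequence `(1 2 ⋯ l) ⟨l ⋯ 2 1⟩`. -/
def twoDown (l : ℕ) : BlockSeq := [.live (List.range l), .dead (List.range l).reverse]

/-- The Class I sequence `T_π(i + 1, j)` for `π = ↗ ↗ ↘^k`, except that the recursion for `j` starts
with `R` empty live blocks instead of two of them.  For large `R` no dead block is short. -/
def combSeq (R : ℕ) : ℕ → ℕ → ℕ → BlockSeq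
  | 0, _, j => twoUp j
  | _ + 1, 0, j => twoDown j
  | _ + 1, _ + 1, 0 => List.replicate R (.live [])
  | k + 1, i + 1, j + 1 =>
    let bot := combSeq R (k + 1) (i + 1) j
    let mid := combSeq R k (i + 1) bot.numLive
    let top := combSeq R (k + 1) i (alphabetSize mid.symbols)
    shuffle true (compose top mid) bot
termination_by k i j => (k, i, j)

theorem combPattern_succ (k : ℕ) : combPattern (k + 1) = combPattern k ++ [Diag.down] := by
  simp [combPattern, List.replicate_succ']

theorem combPattern_dropLast (k : ℕ) : (combPattern (k + 1)).dropLast = combPattern k := by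
  rw [combPattern_succ, List.dropLast_concat]

theorem combPattern_getLast? (k : ℕ) : (combPattern (k + 1)).getLast? = some Diag.down := by
  rw [combPattern_succ, List.getLast?_concat]

theorem classI_combPattern (k i j : ℕ) : classI (combPattern k) (i + 1) j = combSeq 2 k i j := by
  match k, i, j with
  | 0, i, j =>
    rw [classI.eq_def, combSeq, if_pos (by simp [combPattern])]
    simp [twoBlocks, combPattern, twoUp]
  | k + 1, 0, j =>
    rw [classI.eq_def, combSeq, if_pos (by simp)]
    simp [twoBlocks, combPattern_getLast?, twoDown]
  | k + 1, i + 1, 0 =>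
    rw [classI, combSeq, if_neg (by simp [combPattern])]
    rfl
  | k + 1, i + 1, j + 1 =>
    rw [classI, combSeq, if_neg (by simp [combPattern])]
    simp only [combPattern_dropLast, combPattern_getLast?, decide_true,
      classI_combPattern (k + 1) (i + 1) j, Nat.add_sub_cancel]
    simp only [classI_combPattern k (i + 1), classI_combPattern (k + 1) i]
termination_by (k, i, j)

/-! ### The invariants of the construction -/

theorem basic_two {l : ℕ} {D : List ℕ} (hD : D.Perm (List.range l)) :
    Basic l [.live (List.range l), .dead D] := by
  refine ⟨?_, ?_, ?_, ?_⟩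
  · intro B hB
    simp only [List.mem_cons, List.not_mem_nil, or_false] at hB
    rcases hB with rfl | rfl
    · exact List.nodup_range
    · exact hD.nodup_iff.2 List.nodup_range
  · simp
  · intro b M x P hM
    cases b with
    | zero => intros; exact Nat.zero_le _
    | succ b => cases b <;> simp at hM
  · intro x hx
    refine ⟨List.range l, by simp, ?_⟩
    simpa [symbols, Block.symbols, hD.mem_iff] using hx

theorem isCanonical_two {l : ℕ} {D : List ℕ} (hD : D.Perm (List.range l)) :
    IsCanonical [.live (List.range l), .dead D] := by
  have : (symbols [.live (List.range l), .dead D]).toFinset = Finset.range l := by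
    ext x
    simp [symbols, Block.symbols, hD.mem_iff]
  intro x hx
  rw [alphabetSize, this, Finset.card_range]
  simpa [symbols, Block.symbols, hD.mem_iff] using hx

theorem reversing_twoDown (l : ℕ) : Reversing (twoDown l) := by
  intro b M s t x y P Q hM hst hs ht hP hQ hbP hbQ hPQ
  have hb : b = 0 ∧ M = List.range l := by
    cases b with
    | zero => simpa [twoDown, eq_comm] using hM
    | succ b => cases b <;> simp [twoDown] at hM
  obtain ⟨rfl, rfl⟩ := hb
  have key : ∀ {P x}, Occ (twoDown l) P x → 0 < P.1 → P.1 = 1 ∧ P.2 + x + 1 = l := by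
    intro P x hP h0
    have h2 : P.1 < 2 := hP.lt_length
    have h1 : P.1 = 1 := by omega
    obtain ⟨B, hB, hx⟩ := hP
    simp only [h1, twoDown, List.getElem?_cons_succ, List.getElem?_cons_zero,
      Option.some.injEq] at hB
    subst hB
    obtain ⟨hlt, hx⟩ := List.getElem?_eq_some_iff.1 hx
    simp only [Block.symbols, List.length_reverse, List.length_range, List.getElem_reverse,
      List.getElem_range] at hlt hx
    omega
  have h1 := key hP hbP
  have h2 := key hQ hbQ
  have h3 := List.getElem?_eq_some_iff.1 hs
  have h4 := List.getElem?_eq_some_iff.1 ht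
  simp only [List.length_range, List.getElem_range, exists_prop] at h3 h4
  unfold Before at hPQ
  omega

/-- The symbol of the teeth of a comb with `k ≥ 1` occurs at least three times. -/
theorem combFree_of_length_le_two {T : BlockSeq} {k : ℕ} (hk : 1 ≤ k) (hn : NodupBlocks T)
    (hT : T.length ≤ 2) : CombFree T k := by
  intro a z p q r hc
  have o0 := hc.r_occ 0 (by omega)
  have o1 := hc.r_occ 1 (by omega)
  have o2 := hc.r_occ 2 (by omega)
  have h01 := hc.r_before (i := 0) (j := 1) (by omega) (by omega)
  have h12 := hc.r_before (i := 1) (j := 2) (by omega) (by omega)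
  have hne01 : (r 0).1 ≠ (r 1).1 := fun h => h01.ne (o0.eq_of_fst_eq hn o1 h)
  have hne12 : (r 1).1 ≠ (r 2).1 := fun h => h12.ne (o1.eq_of_fst_eq hn o2 h)
  have := h01.fst_le
  have := h12.fst_le
  have := o2.lt_length
  omega

theorem symbols_replicate_live (R : ℕ) : symbols (List.replicate R (.live [])) = [] := by
  simp [symbols, Block.symbols]

/-- The invariants of `combSeq R k i j`. -/
structure CombInvariant (k j : ℕ) (T : BlockSeq) : Prop where
  basic : Basic j T
  canonical : IsCanonical T
  reversing : 1 ≤ k → Reversing T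
  combFree : 1 ≤ k → CombFree T k

theorem combInvariant_combSeq (R k i j : ℕ) : CombInvariant k j (combSeq R k i j) := by
  match k, i, j with
  | 0, i, j =>
    rw [combSeq]
    exact ⟨basic_two (.refl _), isCanonical_two (.refl _), fun h => by omega, fun h => by omega⟩
  | k + 1, 0, j =>
    rw [combSeq]
    have hb : Basic j (twoDown j) := basic_two (List.reverse_perm _)
    exact ⟨hb, isCanonical_two (List.reverse_perm _), fun _ => reversing_twoDown j,
      fun h => combFree_of_length_le_two h hb.nodup le_rfl⟩
  | k + 1, i + 1, 0 =>
    rw [combSeq]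
    have hno : ∀ {P x}, ¬ Occ (List.replicate R (.live [])) P x := fun h => by
      have := h.mem
      rw [symbols_replicate_live] at this
      simp at this
    refine ⟨⟨?_, ?_, ?_, ?_⟩, ?_, ?_, ?_⟩
    · intro B hB
      rw [List.eq_of_mem_replicate hB]
      exact List.nodup_nil
    · intro M hM
      cases List.eq_of_mem_replicate hM
      rfl
    · exact fun b M x P _ _ h => (hno h).elim
    · intro x hx
      rw [symbols_replicate_live] at hx
      simp at hx
    · intro x hx
      rw [symbols_replicate_live] at hx
      simp at hx
    · exact fun _ b M s t x y P Q _ _ _ _ h => (hno h).elim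
    · exact fun _ a z p q r h => (hno (h.r_occ 0 (by omega))).elim
  | k + 1, i + 1, j + 1 =>
    rw [combSeq]
    have hbot := combInvariant_combSeq R (k + 1) (i + 1) j
    set bot := combSeq R (k + 1) (i + 1) j
    have hmid := combInvariant_combSeq R k (i + 1) bot.numLive
    have hadm : MidAdmissible (k + 1) (combSeq R k (i + 1) bot.numLive) := by
      rcases Nat.eq_zero_or_pos k with rfl | hk
      · exact .inl ⟨rfl, _, by rw [combSeq]⟩
      · exact .inr ⟨by omega, hmid.reversing hk, hmid.combFree hk⟩
    set mid := combSeq R k (i + 1) bot.numLive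
    have htop := combInvariant_combSeq R (k + 1) i (alphabetSize mid.symbols)
    set top := combSeq R (k + 1) i (alphabetSize mid.symbols)
    have hU : Basic bot.numLive (compose top mid) :=
      htop.basic.compose hmid.basic hmid.canonical
    obtain ⟨σ, β, hc⟩ := exists_composeIndex (top := top) (mid := mid) fun M x hM hx => by
      rw [htop.basic.live_length M hM]
      exact hmid.canonical x hx
    obtain ⟨σ', β', e, hs⟩ := exists_shuffleIndex hU.live_length
    have hk : 1 ≤ k + 1 := by omega
    have hf := htop.basic.first
    have hn := htop.basic.nodup
    have hr := htop.reversing hk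
    exact ⟨(hU.shuffleFrom hbot.basic).rename (injOn_canonical _), isCanonical_canonical _,
      fun _ => (hs.reversing hU.nodup (hbot.reversing hk)).rename (injOn_canonical _),
      fun _ => (hs.combFree hk hU.nodup hU.first (hbot.combFree hk)
        (hc.not_combAt hk hn hf hr (htop.combFree hk) hadm)
        (fun hM hs ht hst _ _ _ hb h1 h2 h3 h4 h5 hy hxz =>
          hc.not_teeth hn hf hr hadm hM hs ht hst hb h1 h2 h3 h4 h5 hy hxz)).rename
        (injOn_canonical _)⟩
termination_by (k, i, j)

/-! ### Combs as subsequences -/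

theorem teeth_getElem? (s n z i : ℕ) (hi : i < n) :
    ((List.range' s n).flatMap fun a => [a, z])[2 * i]? = some (s + i) ∧
      ((List.range' s n).flatMap fun a => [a, z])[2 * i + 1]? = some z := by
  induction n generalizing s i with
  | zero => omega
  | succ n ih =>
    rw [List.range'_succ, List.flatMap_cons]
    cases i with
    | zero => simp
    | succ i =>
      have := ih (s + 1) i (by omega)
      rw [show 2 * (i + 1) = 2 * i + 2 by ring, show s + (i + 1) = s + 1 + i by ring]
      simpa using this

theorem comb_getElem? (k : ℕ) :
    (∀ i < k + 2, (comb k)[i]? = some (i + 1)) ∧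
    (∀ i ≤ k, (comb k)[k + 2 + 2 * i]? = some (i + 1)) ∧
    (∀ i ≤ k, (comb k)[k + 2 + (2 * i + 1)]? = some (k + 2)) := by
  refine ⟨fun i hi => ?_, fun i hi => ?_, fun i hi => ?_⟩
  · rw [comb, List.getElem?_append_left (by simpa using hi)]
    simp [hi, add_comm]
  · rw [comb, List.getElem?_append_right (by simp), List.length_range', Nat.add_sub_cancel_left,
      (teeth_getElem? 1 (k + 1) (k + 2) i (by omega)).1, add_comm]
  · rw [comb, List.getElem?_append_right (by simp), List.length_range', Nat.add_sub_cancel_left,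
      (teeth_getElem? 1 (k + 1) (k + 2) i (by omega)).2]

/-- A subsequence of `T` occurs at increasing positions. -/
theorem exists_positions {T : BlockSeq} {τ : List ℕ} (h : τ.Sublist (symbols T)) :
    ∃ f : ℕ → ℕ × ℕ, (∀ n x, τ[n]? = some x → Occ T (f n) x) ∧
      ∀ m n, m < n → n < τ.length → Before (f m) (f n) := by
  obtain ⟨g, hg⟩ := List.sublist_iff_exists_orderEmbedding_getElem?_eq.1 h
  have hs : symbols T = (T.map Block.symbols).flatten := by rw [symbols, List.flatMap_def]
  rw [hs] at hg
  obtain ⟨σ, β, h1, h2⟩ := exists_flatten_index (T.map Block.symbols)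
  refine ⟨fun n => (σ (g n), β (g n)), fun n x hx => ?_, fun m n hmn hn => ?_⟩
  · rw [hg n] at hx
    obtain ⟨S, hS, hx⟩ := h1 _ _ hx
    rw [List.getElem?_map, Option.map_eq_some_iff] at hS
    obtain ⟨B, hB, rfl⟩ := hS
    exact ⟨B, hB, hx⟩
  · refine h2 _ _ (g.strictMono hmn) ?_
    have := hg n
    rw [List.getElem?_eq_getElem hn] at this
    exact (List.getElem?_eq_some_iff.1 this.symm).1

theorem CombFree.not_contains {T : BlockSeq} {k : ℕ} (h : CombFree T k) :
    ¬ Contains (symbols T) (comb k) := by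
  rintro ⟨τ, hτ, f, hf, rfl⟩
  obtain ⟨g, hg1, hg2⟩ := exists_positions hτ
  obtain ⟨c1, c2, c3⟩ := comb_getElem? k
  have occ : ∀ {n x}, (comb k)[n]? = some x → Occ T (g n) (f x) := fun {n x} hx =>
    hg1 n _ (by rw [List.getElem?_map, hx]; rfl)
  have bef : ∀ m n x, (comb k)[n]? = some x → m < n → Before (g m) (g n) := fun m n x hx hmn =>
    hg2 m n hmn (by rw [List.length_map]; exact (List.getElem?_eq_some_iff.1 hx).1)
  have mem : ∀ i < k + 2, i + 1 ∈ comb k := fun i hi => List.mem_of_getElem? (c1 i hi)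
  have cr : ∀ i ≤ k + 1, (comb k)[k + 1 + 2 * i]? = some (k + 2) := by
    intro i hi
    cases i with
    | zero => exact c1 (k + 1) (by omega)
    | succ i =>
      rw [show k + 1 + 2 * (i + 1) = k + 2 + (2 * i + 1) by ring]
      exact c3 i (by omega)
  refine h (fun i => f (i + 1)) (f (k + 2)) g (fun i => g (k + 2 + 2 * i))
    (fun i => g (k + 1 + 2 * i)) ⟨fun i hi he => ?_, fun i hi he => ?_,
      fun i hi => occ (c1 i (by omega)), fun i hi => occ (c2 i hi), fun i hi => occ (cr i hi),
      fun i hi => .inl (bef _ _ _ (c1 (i + 1) (by omega)) (by omega)),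
      fun i hi => bef _ _ _ (cr 0 (by omega)) (by omega),
      fun i hi => bef _ _ _ (c2 i hi) (by omega),
      fun i hi => bef _ _ _ (cr (i + 1) (by omega)) (by omega)⟩
  · have := hf (mem i (by omega)) (mem (k + 1) (by omega)) he
    omega
  · have := hf (mem i (by omega)) (mem (i + 1) (by omega)) he
    omega

/-! ### Counting live blocks, symbols and lengths -/

theorem numLive_compose (top mid : BlockSeq) :
    numLive (compose top mid) = numLive top * numLive mid := by
  induction top with
  | nil => simp [compose]
  | cons B T ih =>
    unfold compose at ih ⊢
    rw [List.flatMap_cons, numLive_append, ih]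
    cases B with
    | dead D => simp
    | live M => simp [numLive_rename, Nat.add_mul, Nat.add_comm]

theorem numLive_insertLive (pre : Bool) (as : List ℕ) (T : BlockSeq) :
    numLive (insertLive pre as T) = numLive T := by
  induction T generalizing as with
  | nil => cases as <;> rfl
  | cons B T ih => cases B <;> cases as <;> simp [insertLive, ih]

theorem numLive_shuffleFrom (pre : Bool) (bot : BlockSeq) (q : ℕ) (U : BlockSeq) :
    numLive (shuffleFrom pre bot q U) = numLive U * numLive bot := by
  induction U generalizing q with
  | nil => simp [shuffleFrom]
  | cons B U ih =>
    cases B with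
    | dead D => simp [shuffleFrom, ih]
    | live M =>
      simp [shuffleFrom, ih, numLive_insertLive, numLive_rename, Nat.add_mul, Nat.add_comm]

theorem numLive_shuffle (pre : Bool) (U bot : BlockSeq) :
    numLive (shuffle pre U bot) = numLive U * numLive bot := by
  rw [shuffle, canonical, numLive_rename, numLive_shuffleFrom]

@[simp] theorem symbols_cons (B : Block) (T : BlockSeq) :
    symbols (B :: T) = B.symbols ++ symbols T := List.flatMap_cons

@[simp] theorem symbols_append (S T : BlockSeq) : symbols (S ++ T) = symbols S ++ symbols T :=
  List.flatMap_append

theorem length_symbols_compose {top mid : BlockSeq} {N : ℕ}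
    (h : ∀ M, .live M ∈ top → M.length = N) :
    (symbols (compose top mid)).length + numLive top * N =
      (symbols top).length + numLive top * (symbols mid).length := by
  induction top with
  | nil => simp [compose, symbols]
  | cons B T ih =>
    have ih := ih fun M hM => h M (List.mem_cons_of_mem _ hM)
    unfold compose at ih ⊢
    rw [List.flatMap_cons, symbols_append, symbols_cons, List.length_append, List.length_append]
    cases B with
    | dead D =>
      have hD : symbols [.dead D] = D := by simp [symbols, Block.symbols]
      simp only [numLive_cons_dead, hD, Block.symbols]
      omega
    | live M =>
      have hM := h M List.mem_cons_self
      simp only [numLive_cons_live, symbols_rename, List.length_map, Block.symbols, Nat.add_mul]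
      omega

theorem length_symbols_insertLive (as : List ℕ) (T : BlockSeq) (h : as.length = numLive T) :
    (symbols (insertLive true as T)).length = as.length + (symbols T).length := by
  induction T generalizing as with
  | nil => simp_all [insertLive, symbols]
  | cons B T ih =>
    cases B with
    | dead D =>
      have := ih as (by simpa using h)
      simp only [insertLive, symbols_cons, List.length_append, this]
      omega
    | live D =>
      cases as with
      | nil => simp at h
      | cons a as =>
        have := ih as (by simpa using h)
        simp only [insertLive, symbols_cons, List.length_append, this, Block.symbols, if_true,
          List.length_cons]
        omega

theorem length_symbols_shuffleFrom {U bot : BlockSeq} (q : ℕ)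
    (h : ∀ M, .live M ∈ U → M.length = bot.numLive) :
    (symbols (shuffleFrom true bot q U)).length =
      (symbols U).length + numLive U * (symbols bot).length := by
  induction U generalizing q with
  | nil => simp [shuffleFrom, symbols]
  | cons B U ih =>
    have ih := fun q => ih q fun M hM => h M (List.mem_cons_of_mem _ hM)
    cases B with
    | dead D =>
      simp only [shuffleFrom, symbols_cons, List.length_append, ih, Block.symbols,
        List.length_map, numLive_cons_dead]
      omega
    | live M =>
      have hM := h M List.mem_cons_self
      simp only [shuffleFrom, symbols_cons, symbols_append, List.length_append, ih, Block.symbols,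
        numLive_cons_live]
      rw [length_symbols_insertLive _ _ (by rw [numLive_rename, List.length_map, hM]),
        symbols_rename, List.length_map, List.length_map, Nat.add_mul]
      omega

/-- Every symbol is in exactly one live block, so the live blocks contain each symbol once. -/
theorem Basic.alphabetSize_eq {j : ℕ} {T : BlockSeq} (h : Basic j T) :
    alphabetSize (symbols T) = j * numLive T := by
  let L := T.filter Block.isLive
  have hlive : ∀ B ∈ L, ∃ M, B = .live M ∧ .live M ∈ T := by
    intro B hB
    obtain ⟨h1, h2⟩ := List.mem_filter.1 hB
    cases B with
    | dead D => simp [Block.isLive] at h2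
    | live M => exact ⟨M, rfl, h1⟩
  have hset : (symbols T).toFinset = (symbols L).toFinset := by
    ext x
    simp only [List.mem_toFinset]
    constructor
    · intro hx
      obtain ⟨M, hM, hxM⟩ := h.cover x hx
      exact mem_symbols.2 ⟨_, List.mem_filter.2 ⟨hM, rfl⟩, hxM⟩
    · intro hx
      obtain ⟨B, hB, hxB⟩ := mem_symbols.1 hx
      exact mem_symbols.2 ⟨B, (List.mem_filter.1 hB).1, hxB⟩
  have hnodup : (symbols L).Nodup := by
    refine List.nodup_flatMap.2 ⟨fun B hB => h.nodup B (List.mem_filter.1 hB).1, ?_⟩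
    refine List.pairwise_filter.2 (List.pairwise_iff_getElem.2 ?_)
    intro i i' hi hi' hlt h1 h2 x hx hx'
    generalize he : T[i] = B at h1 hx
    generalize he' : T[i'] = B' at h2 hx'
    cases B with
    | dead D => simp [Block.isLive] at h1
    | live M =>
      cases B' with
      | dead D => simp [Block.isLive] at h2
      | live M' =>
        obtain ⟨t, ht⟩ := List.mem_iff_getElem?.1 hx
        have := h.first i' M' x (i, t) (List.getElem?_eq_some_iff.2 ⟨hi', he'⟩) hx'
          ⟨_, List.getElem?_eq_some_iff.2 ⟨hi, he⟩, ht⟩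
        simp only at this
        omega
  have hlen : ∀ L' : BlockSeq, (∀ B ∈ L', ∃ M, B = .live M ∧ .live M ∈ T) →
      (symbols L').length = j * L'.length := by
    intro L' hL'
    induction L' with
    | nil => rfl
    | cons B L' ih =>
      obtain ⟨M, rfl, hM⟩ := hL' B List.mem_cons_self
      rw [symbols_cons, List.length_append, ih fun B hB => hL' B (List.mem_cons_of_mem _ hB),
        List.length_cons, Block.symbols, h.live_length M hM]
      ring
  rw [alphabetSize, hset, List.toFinset_card_of_nodup hnodup, hlen L hlive, numLive,
    List.countP_eq_length_filter]

section

variable (R k i j : ℕ)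

theorem alphabetSize_combSeq :
    alphabetSize (combSeq R k i j).symbols = j * (combSeq R k i j).numLive :=
  (combInvariant_combSeq R k i j).basic.alphabetSize_eq

theorem numLive_combSeq_succ :
    (combSeq R (k + 1) (i + 1) (j + 1)).numLive =
      (combSeq R (k + 1) i ((combSeq R (k + 1) (i + 1) j).numLive *
        (combSeq R k (i + 1) (combSeq R (k + 1) (i + 1) j).numLive).numLive)).numLive *
      (combSeq R k (i + 1) (combSeq R (k + 1) (i + 1) j).numLive).numLive *
      (combSeq R (k + 1) (i + 1) j).numLive := by
  rw [combSeq, numLive_shuffle, numLive_compose, alphabetSize_combSeq]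

end

theorem numLive_combSeq_pos {R : ℕ} (hR : 1 ≤ R) (k i j : ℕ) : 1 ≤ (combSeq R k i j).numLive := by
  match k, i, j with
  | 0, i, j => rw [combSeq]; simp [twoUp]
  | k + 1, 0, j => rw [combSeq]; simp [twoDown]
  | k + 1, i + 1, 0 =>
    rw [combSeq, numLive, List.countP_replicate]
    simpa [Block.isLive] using hR
  | k + 1, i + 1, j + 1 =>
    rw [numLive_combSeq_succ]
    exact Nat.mul_pos (Nat.mul_pos (numLive_combSeq_pos hR _ _ _) (numLive_combSeq_pos hR _ _ _))
      (numLive_combSeq_pos hR _ _ _)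
termination_by (k, i, j)

theorem le_numLive_combSeq {R : ℕ} (hR : 1 ≤ R) (k i j : ℕ) :
    R ≤ (combSeq R (k + 1) (i + 1) j).numLive := by
  induction j with
  | zero =>
    rw [combSeq, numLive, List.countP_replicate]
    simp [Block.isLive]
  | succ j ih =>
    rw [numLive_combSeq_succ]
    exact ih.trans (Nat.le_mul_of_pos_left _
      (Nat.mul_pos (numLive_combSeq_pos hR _ _ _) (numLive_combSeq_pos hR _ _ _)))

/-- Every symbol of `combSeq R k i j` occurs once in a live block and `(i + k).choose k` times in
dead blocks. -/
theorem length_combSeq (R k i j : ℕ) : (combSeq R k i j).symbols.length =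
    (1 + (i + k).choose k) * (j * (combSeq R k i j).numLive) := by
  match k, i, j with
  | 0, i, j =>
    rw [combSeq]
    simp [twoUp, symbols, Block.symbols]
    ring
  | k + 1, 0, j =>
    rw [combSeq]
    simp [twoDown, symbols, Block.symbols]
    ring
  | k + 1, i + 1, 0 =>
    rw [combSeq, symbols_replicate_live]
    simp
  | k + 1, i + 1, j + 1 =>
    have hl := numLive_combSeq_succ R k i j
    rw [hl, combSeq, shuffle, canonical, symbols_rename, List.length_map]
    have hb := length_combSeq R (k + 1) (i + 1) j
    set bot := combSeq R (k + 1) (i + 1) j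
    have hm := length_combSeq R k (i + 1) bot.numLive
    have ha := alphabetSize_combSeq R k (i + 1) bot.numLive
    have im := combInvariant_combSeq R k (i + 1) bot.numLive
    set mid := combSeq R k (i + 1) bot.numLive
    have ht := length_combSeq R (k + 1) i (alphabetSize mid.symbols)
    have it := combInvariant_combSeq R (k + 1) i (alphabetSize mid.symbols)
    rw [ha] at ht it ⊢
    set top := combSeq R (k + 1) i (bot.numLive * mid.numLive)
    have hU : Basic bot.numLive (compose top mid) :=
      Basic.compose (ha ▸ it.basic) im.basic im.canonical
    rw [length_symbols_shuffleFrom 0 hU.live_length, numLive_compose, hb]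
    have h1 := length_symbols_compose (mid := mid) it.basic.live_length
    have hc : (i + 1 + (k + 1)).choose (k + 1) =
        (i + 1 + k).choose k + (i + (k + 1)).choose (k + 1) := by
      rw [show i + 1 + (k + 1) = (i + 1 + k) + 1 by ring, Nat.choose_succ_succ,
        show i + 1 + k = i + (k + 1) by ring]
    rw [ht, hm] at h1
    rw [hc]
    generalize (i + 1 + k).choose k = c₁ at *
    generalize (i + (k + 1)).choose (k + 1) = c₂ at *
    generalize (symbols (compose top mid)).length = u at *
    generalize numLive top = t at *
    generalize numLive mid = m at *
    generalize numLive bot = b at *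
    have : u = (1 + (c₁ + c₂)) * (t * m * b) := by
      apply Nat.add_right_cancel (m := t * (b * m))
      rw [h1]
      ring
    rw [this]
    ring
termination_by (k, i, j)

/-! ### Lengths of the dead blocks -/

theorem dead_mem_compose {top mid : BlockSeq} {D : List ℕ} (h : .dead D ∈ compose top mid) :
    .dead D ∈ top ∨ ∃ D', .dead D' ∈ mid ∧ D'.length = D.length := by
  obtain ⟨B, hB, h⟩ := List.mem_flatMap.1 h
  cases B with
  | dead D' =>
    simp only [List.mem_singleton] at h
    exact .inl (h ▸ hB)
  | live M =>
    obtain ⟨E, hE, h⟩ := List.mem_map.1 h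
    cases E with
    | live _ => simp [Block.rename] at h
    | dead D' =>
      simp only [Block.rename, Block.dead.injEq] at h
      exact .inr ⟨D', hE, by simp [← h]⟩

theorem dead_mem_insertLive {pre : Bool} {as : List ℕ} {T : BlockSeq} {D : List ℕ}
    (h : .dead D ∈ insertLive pre as T) : .dead D ∈ T := by
  induction T generalizing as with
  | nil => cases as <;> simp [insertLive] at h
  | cons B T ih =>
    cases B <;> cases as <;> simp only [insertLive, List.mem_cons, reduceCtorEq, false_or] at h ⊢
    · exact ih h
    · exact ih h
    · exact h.imp id ih
    · exact h.imp id ih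

theorem dead_mem_rename {f : ℕ → ℕ} {T : BlockSeq} {D : List ℕ} (h : .dead D ∈ T.rename f) :
    ∃ D', .dead D' ∈ T ∧ D'.length = D.length := by
  obtain ⟨E, hE, h⟩ := List.mem_map.1 h
  cases E with
  | live _ => simp [Block.rename] at h
  | dead D' =>
    simp only [Block.rename, Block.dead.injEq] at h
    exact ⟨D', hE, by simp [← h]⟩

theorem dead_mem_shuffleFrom {pre : Bool} {bot : BlockSeq} {q : ℕ} {U : BlockSeq} {D : List ℕ}
    (h : .dead D ∈ shuffleFrom pre bot q U) :
    ∃ D', (.dead D' ∈ U ∨ .dead D' ∈ bot) ∧ D'.length = D.length := by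
  induction U generalizing q with
  | nil => simp [shuffleFrom] at h
  | cons B U ih =>
    cases B with
    | dead D' =>
      rcases List.mem_cons.1 h with h | h
      · exact ⟨D', .inl List.mem_cons_self, by cases h; simp⟩
      · obtain ⟨D', h1, h2⟩ := ih h
        exact ⟨D', h1.imp (List.mem_cons_of_mem _) id, h2⟩
    | live M =>
      rcases List.mem_append.1 h with h | h
      · obtain ⟨D', h1, h2⟩ := dead_mem_rename (dead_mem_insertLive h)
        exact ⟨D', .inr h1, h2⟩
      · obtain ⟨D', h1, h2⟩ := ih h
        exact ⟨D', h1.imp (List.mem_cons_of_mem _) id, h2⟩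

theorem dead_length_combSeq {R : ℕ} (hR : 1 ≤ R) (k i j : ℕ) (h : R ≤ j ∨ 1 ≤ k ∧ 1 ≤ i)
    {D : List ℕ} (hD : .dead D ∈ combSeq R k i j) : R ≤ D.length := by
  match k, i, j with
  | 0, i, j =>
    rw [combSeq, twoUp] at hD
    simp at hD
    subst hD
    simp; omega
  | k + 1, 0, j =>
    rw [combSeq, twoDown] at hD
    simp at hD
    subst hD
    simp; omega
  | k + 1, i + 1, 0 =>
    rw [combSeq] at hD
    cases List.eq_of_mem_replicate hD
  | k + 1, i + 1, j + 1 =>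
    have hl := le_numLive_combSeq hR k i j
    rw [combSeq, shuffle, canonical] at hD
    obtain ⟨D₁, h1, e1⟩ := dead_mem_rename hD
    obtain ⟨D₂, h2, e2⟩ := dead_mem_shuffleFrom h1
    rw [← e1, ← e2]
    rcases h2 with h2 | h2
    · rcases dead_mem_compose h2 with h3 | ⟨D₃, h3, e3⟩
      · refine dead_length_combSeq hR (k + 1) i _ (.inl ?_) h3
        rw [alphabetSize_combSeq]
        exact hl.trans (Nat.le_mul_of_pos_right _ (numLive_combSeq_pos hR _ _ _))
      · rw [← e3]
        exact dead_length_combSeq hR k (i + 1) _ (.inl hl) h3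
    · exact dead_length_combSeq hR (k + 1) (i + 1) j (.inr ⟨by omega, by omega⟩) h2
termination_by (k, i, j)

/-! ### Sparse sequences over disjoint alphabets -/

theorem Contains.mono {S S' σ : List ℕ} (h : Contains S σ) (hS : S.Sublist S') : Contains S' σ := by
  obtain ⟨τ, hτ, hi⟩ := h
  exact ⟨τ, hτ.trans hS, hi⟩

theorem Contains.of_map {S σ : List ℕ} {f : ℕ → ℕ} (hf : Function.Injective f)
    (h : Contains (S.map f) σ) : Contains S σ := by
  obtain ⟨τ, hτ, g, hg, rfl⟩ := h
  obtain ⟨τ', hτ', he⟩ := List.sublist_map_iff.1 hτ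
  refine ⟨τ', hτ', Function.invFun f ∘ g, fun x hx y hy hxy => hg hx hy ?_, ?_⟩
  · have key : ∀ {x}, x ∈ σ → f (Function.invFun f (g x)) = g x := by
      intro x hx
      have : g x ∈ τ'.map f := he ▸ List.mem_map_of_mem hx
      obtain ⟨y, -, hy⟩ := List.mem_map.1 this
      exact Function.invFun_eq ⟨y, hy⟩
    rw [← key hx, ← key hy]
    exact congrArg f hxy
  · rw [← List.map_map, he, List.map_map, Function.invFun_comp hf, List.map_id]

/-- The comb cannot be split into two nonempty parts without a common symbol. -/
theorem comb_split {k : ℕ} {u v : List ℕ} (h : comb k = u ++ v)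
    (hd : ∀ x ∈ u, x ∉ v) : u = [] ∨ v = [] := by
  by_contra! hne
  obtain ⟨hu, hv⟩ := hne
  obtain ⟨c1, c2, c3⟩ := comb_getElem? k
  have hul : 0 < u.length := List.length_pos_iff.2 hu
  have hvl : 0 < v.length := List.length_pos_iff.2 hv
  have left : ∀ {n x}, (comb k)[n]? = some x → n < u.length → x ∈ u := fun hx hn => by
    rw [h, List.getElem?_append_left hn] at hx
    exact List.mem_of_getElem? hx
  have right : ∀ {n x}, (comb k)[n]? = some x → u.length ≤ n → x ∈ v := fun hx hn => by
    rw [h, List.getElem?_append_right hn] at hx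
    exact List.mem_of_getElem? hx
  by_cases hk : u.length ≤ k + 2
  · exact hd _ (left (c1 0 (by omega)) hul) (right (c2 0 (by omega)) (by omega))
  · have hlen : (comb k).length = k + 2 + (2 * k + 2) := by
      simp [comb, List.length_flatMap]
      ring
    have : (comb k).length = u.length + v.length := by rw [h, List.length_append]
    exact hd _ (left (c1 (k + 1) (by omega)) (by omega)) (right (c3 k le_rfl) (by omega))

theorem not_contains_append {k : ℕ} {S S' : List ℕ} (h : ¬ Contains S (comb k))
    (h' : ¬ Contains S' (comb k)) (hd : ∀ x ∈ S, x ∉ S') : ¬ Contains (S ++ S') (comb k) := by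
  rintro ⟨τ, hτ, f, hf, he⟩
  obtain ⟨τ₁, τ₂, rfl, h1, h2⟩ := List.sublist_append_iff.1 hτ
  obtain ⟨u, v, huv, rfl, rfl⟩ := List.map_eq_append_iff.1 he
  rcases comb_split huv fun x hx hx' => hd (f x) (h1.subset (List.mem_map_of_mem hx))
    (h2.subset (List.mem_map_of_mem hx')) with rfl | rfl
  · rw [List.nil_append] at huv
    exact h' ⟨_, h2, f, huv ▸ hf, by rw [huv]⟩
  · rw [List.append_nil] at huv
    exact h ⟨_, h1, f, huv ▸ hf, by rw [huv]⟩

theorem not_contains_of_nodup {k : ℕ} {S : List ℕ} (hS : S.Nodup) : ¬ Contains S (comb k) := by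
  rintro ⟨τ, hτ, f, hf, rfl⟩
  have hn : (comb k).Nodup := List.Nodup.of_map f (hτ.nodup hS)
  obtain ⟨c1, c2, -⟩ := comb_getElem? k
  have h0 := c1 0 (by omega)
  have := (List.getElem?_inj (List.getElem?_eq_some_iff.1 h0).1 hn).1
    (h0.trans (c2 0 (by omega)).symm)
  omega

theorem IsSparse.map {r : ℕ} {S : List ℕ} (h : IsSparse r S) {f : ℕ → ℕ}
    (hf : Function.Injective f) : IsSparse r (S.map f) := by
  intro p q hp hq hpq he
  simp only [List.length_map] at hp hq
  simp only [List.getElem_map] at he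
  exact h p q hp hq hpq (hf he)

theorem IsSparse.append {r : ℕ} {S S' : List ℕ} (h : IsSparse r S) (h' : IsSparse r S')
    (hd : ∀ x ∈ S, x ∉ S') : IsSparse r (S ++ S') := by
  intro p q hp hq hpq he
  rw [List.length_append] at hp hq
  by_cases hp' : p < S.length
  · rw [List.getElem_append_left hp'] at he
    by_cases hq' : q < S.length
    · rw [List.getElem_append_left hq'] at he
      exact h p q hp' hq' hpq he
    · rw [List.getElem_append_right (by omega)] at he
      exact (hd _ (List.getElem_mem hp') (he ▸ List.getElem_mem _)).elim
  · rw [List.getElem_append_right (by omega), List.getElem_append_right (by omega)] at he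
    have := h' _ _ (by omega) (by omega) (by omega) he
    omega

theorem IsSparse.of_nodup {r : ℕ} {S : List ℕ} (h : S.Nodup) : IsSparse r S := by
  intro p q hp hq hpq he
  have := h.getElem_inj_iff.1 he
  omega

theorem alphabetSize_append {S S' : List ℕ} (hd : ∀ x ∈ S, x ∉ S') :
    alphabetSize (S ++ S') = alphabetSize S + alphabetSize S' := by
  unfold alphabetSize
  rw [List.toFinset_append, Finset.card_union_of_disjoint]
  exact Finset.disjoint_left.2 fun x hx hx' =>
    hd x (List.mem_toFinset.1 hx) (List.mem_toFinset.1 hx')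

theorem add_mem_freeLengths {k n n' L L' : ℕ} (h : L ∈ freeLengths (comb k) n)
    (h' : L' ∈ freeLengths (comb k) n') : L + L' ∈ freeLengths (comb k) (n + n') := by
  obtain ⟨S, rfl, hf, rfl, hs⟩ := h
  obtain ⟨S', rfl, hf', rfl, hs'⟩ := h'
  have i1 : Function.Injective fun x : ℕ => 2 * x := fun x y hxy => by simpa using hxy
  have i2 : Function.Injective fun x : ℕ => 2 * x + 1 := fun x y hxy => by simpa using hxy
  have hd : ∀ x ∈ S.map (2 * ·), x ∉ S'.map (2 * · + 1) := by
    intro x hx hx'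
    obtain ⟨y, -, rfl⟩ := List.mem_map.1 hx
    obtain ⟨y', -, hy⟩ := List.mem_map.1 hx'
    omega
  exact ⟨S.map (2 * ·) ++ S'.map (2 * · + 1), by simp,
    not_contains_append (fun h => hf (h.of_map i1)) (fun h => hf' (h.of_map i2)) hd,
    by rw [alphabetSize_append hd, alphabetSize_map i1.injOn, alphabetSize_map i2.injOn],
    (hs.map i1).append (hs'.map i2) hd⟩

theorem self_mem_freeLengths (k n : ℕ) : n ∈ freeLengths (comb k) n :=
  ⟨List.range n, by simp, not_contains_of_nodup List.nodup_range,
    by rw [alphabetSize, List.toFinset_card_of_nodup List.nodup_range, List.length_range],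
    .of_nodup List.nodup_range⟩

theorem mul_mem_freeLengths {k n L : ℕ} (h : L ∈ freeLengths (comb k) n) (m : ℕ) :
    m * L ∈ freeLengths (comb k) (m * n) := by
  induction m with
  | zero => simpa using self_mem_freeLengths k 0
  | succ m ih =>
    rw [Nat.add_mul, Nat.add_mul, Nat.one_mul, Nat.one_mul]
    exact add_mem_freeLengths ih h

theorem le_Ex {k n L : ℕ} (h : L ∈ freeLengths (comb k) n) : L ≤ Ex (comb k) n :=
  le_csSup (bddAbove_freeLengths _ _) h

theorem self_le_Ex (k n : ℕ) : n ≤ Ex (comb k) n := le_Ex (self_mem_freeLengths k n)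

/-- Disjoint copies of a sequence over at most `N` symbols, and further symbols occurring once. -/
theorem mul_le_Ex {k m N L n : ℕ} (h : L ∈ freeLengths (comb k) m) (hN : m ≤ N) :
    n / N * L ≤ Ex (comb k) n := by
  have h1 : n / N * m ≤ n := (Nat.mul_le_mul_left _ hN).trans (Nat.div_mul_le_self n N)
  have := le_Ex (add_mem_freeLengths (mul_mem_freeLengths h (n / N))
    (self_mem_freeLengths k (n - n / N * m)))
  rw [Nat.add_sub_cancel' h1] at this
  omega

theorem alphabetSize_comb (k : ℕ) : alphabetSize (comb k) = k + 2 := by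
  have : (comb k).toFinset = Finset.Icc 1 (k + 2) := by
    ext x
    simp only [comb, List.toFinset_append, Finset.mem_union, List.mem_toFinset, List.mem_range'_1,
      List.mem_flatMap, List.mem_cons, List.not_mem_nil, or_false, Finset.mem_Icc]
    constructor
    · rintro (h | ⟨a, ha, rfl | rfl⟩) <;> omega
    · intro h
      exact .inl (by omega)
  rw [alphabetSize, this, Nat.card_Icc]
  omega

/-! ### Making blocked sequences sparse -/

/-- Deleting from a block with distinct symbols those among the last `r - 1` symbols of the
preceding sequence makes it possible to append the block and stay `r`-sparse. -/
theorem IsSparse.append_block {r : ℕ} {S B : List ℕ} (h : IsSparse r S) (hB : B.Nodup) :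
    ∃ B', B'.Sublist B ∧ IsSparse r (S ++ B') ∧ B.length ≤ B'.length + (r - 1) := by
  let W := S.drop (S.length - (r - 1))
  have hW : W.length ≤ r - 1 := by simp only [W, List.length_drop]; omega
  refine ⟨B.filter (· ∉ W), List.filter_sublist, ?_, ?_⟩
  · intro p q hp hq hpq he
    rw [List.length_append] at hp hq
    by_cases hp' : p < S.length
    · rw [List.getElem_append_left hp'] at he
      by_cases hq' : q < S.length
      · rw [List.getElem_append_left hq'] at he
        exact h p q hp' hq' hpq he
      · rw [List.getElem_append_right (by omega)] at he
        by_contra hlt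
        have h1 : S[p] ∈ B.filter (· ∉ W) := he ▸ List.getElem_mem _
        have h2 : S[p] ∉ W := by simpa using (List.mem_filter.1 h1).2
        refine h2 (List.mem_iff_getElem.2 ⟨p - (S.length - (r - 1)), ?_, ?_⟩)
        · simp only [W, List.length_drop]
          omega
        · simp only [W, List.getElem_drop]
          congr 1
          omega
    · rw [List.getElem_append_right (by omega), List.getElem_append_right (by omega)] at he
      have := (hB.filter _).getElem_inj_iff.1 he
      omega
  · have h1 : B.length = (B.filter (· ∉ W)).length + (B.filter (· ∈ W)).length := by
      have := List.length_eq_length_filter_add (l := B) (· ∉ W)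
      simpa using this
    have h2 : (B.filter (· ∈ W)).length ≤ W.length :=
      ((hB.filter _).subperm fun x hx => by simpa using (List.mem_filter.1 hx).2).length_le
    omega

theorem exists_isSparse_sublist {T : BlockSeq} (hT : NodupBlocks T) (r : ℕ) :
    ∃ S, S.Sublist (symbols T) ∧ IsSparse r S ∧
      (symbols T).length ≤ S.length + (r - 1) * T.length := by
  induction T using List.reverseRecOn with
  | nil => exact ⟨[], by simp, .of_nodup List.nodup_nil, by simp [symbols]⟩
  | append_singleton T B ih =>
    obtain ⟨S, h1, h2, h3⟩ := ih fun B hB => hT B (List.mem_append_left _ hB)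
    obtain ⟨B', h4, h5, h6⟩ := h2.append_block (hT B (by simp))
    have hs : symbols (T ++ [B]) = symbols T ++ B.symbols := by simp [symbols]
    refine ⟨S ++ B', ?_, h5, ?_⟩
    · rw [hs]
      exact h1.append h4
    · rw [hs, List.length_append, List.length_append, List.length_append, Nat.mul_add]
      simp only [List.length_singleton]
      omega

/-! ### Growth of the construction and of the Ackermann array -/

theorem ackArray_succ_succ (m n : ℕ) : ackArray (m + 2) (n + 2) =
    ackArray (m + 2) (n + 1) * ackArray (m + 1) (ackArray (m + 2) (n + 1)) := by
  rw [ackArray]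

theorem ackArray_le_succ_succ (m n : ℕ) :
    ackArray (m + 1) (ackArray (m + 2) (n + 1)) ≤ ackArray (m + 2) (n + 2) := by
  rw [ackArray_succ_succ]
  exact Nat.le_mul_of_pos_left _ (ackArray_pos (m + 1) n)

theorem ackArray_mono (m : ℕ) {n n' : ℕ} (hn : 1 ≤ n) (h : n ≤ n') :
    ackArray (m + 1) n ≤ ackArray (m + 1) n' := by
  induction n', h using Nat.le_induction with
  | base => exact le_rfl
  | succ n' h ih =>
    refine ih.trans ?_
    obtain ⟨n', rfl⟩ := Nat.exists_eq_add_of_le' (hn.trans h)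
    cases m with
    | zero =>
      rw [Nat.zero_add, ackArray, ackArray]
      exact Nat.pow_le_pow_right (by norm_num) (by omega)
    | succ m =>
      rw [ackArray_succ_succ]
      obtain ⟨w, hw⟩ := Nat.exists_eq_succ_of_ne_zero (ackArray_pos (m + 1) n').ne'
      refine Nat.le_mul_of_pos_right _ ?_
      rw [hw]
      exact ackArray_pos m w

theorem ackArray_two_eq (m : ℕ) : ackArray (m + 1) 2 = 2 ^ (m + 2) := by
  induction m with
  | zero => simp [ackArray]
  | succ m ih => rw [ackArray, ackArray, ih]; ring

/-- The summand `3` on the left makes the induction work: it absorbs the shift of the second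
argument when the two recursions are compared. -/
theorem ack_add_three_le (m n : ℕ) : ack m n + 3 ≤ ackArray (m + 1) (n + 3) := by
  induction m generalizing n with
  | zero =>
    rw [ack_zero, ackArray]
    have : n + 3 < 2 ^ (n + 3) := Nat.lt_two_pow_self
    omega
  | succ m ih =>
    induction n with
    | zero =>
      rw [ack_succ_zero]
      refine (ih 1).trans ((ackArray_mono m (by omega) ?_).trans (ackArray_le_succ_succ m 1))
      rw [ackArray_two_eq]
      calc 1 + 3 ≤ 2 ^ 3 := by norm_num
        _ ≤ 2 ^ (m + 1 + 2) := Nat.pow_le_pow_right (by norm_num) (by omega)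
    | succ n ihn =>
      rw [ack_succ_succ]
      refine (ih _).trans ((ackArray_mono m (by omega) ?_).trans (ackArray_le_succ_succ m (n + 2)))
      exact ihn

/-- The Ackermann function at a fixed second argument is bounded by the third column. -/
theorem ack_le_ackArray_three {m n : ℕ} (h : n + 3 ≤ 2 ^ (m + 3)) :
    ack m n ≤ ackArray (m + 2) 3 := by
  have h1 := ack_add_three_le m n
  have h2 : ackArray (m + 1) (n + 3) ≤ ackArray (m + 2) 3 := by
    refine (ackArray_mono m (by omega) ?_).trans (ackArray_le_succ_succ m 1)
    rw [ackArray_two_eq]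
    exact h
  omega

/-- The bound for one step of the recursion `L(i, j + 1) = b * a * v`, where `v = L(i, j)`, and
`a` and `b` are the numbers of live blocks of `mid` and `top`. -/
theorem ack_step {m v R a b : ℕ} (hR : R ≤ v) (ha : a ≤ ack m (2 * v))
    (hb : b ≤ ack m (v * a + R)) : b * a * v ≤ ack (m + 7) v := by
  set w := ack m (2 * v) with hw
  have hvw : 2 * v < w := lt_ack_right _ _
  have h1 : v * a + R ≤ (w + 1) ^ 2 := by nlinarith
  have h2 : b ≤ ack m ((w + 1) ^ 2) := hb.trans (ack_mono_right m h1)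
  have h3 : (w + 1) ^ 2 < ack m ((w + 1) ^ 2) := lt_ack_right _ _
  have h4 : a * v ≤ ack m ((w + 1) ^ 2) := by nlinarith
  calc b * a * v = b * (a * v) := by ring
    _ ≤ ack m ((w + 1) ^ 2) * ack m ((w + 1) ^ 2) := Nat.mul_le_mul h2 h4
    _ ≤ (ack m ((w + 1) ^ 2) + 1) ^ 2 := by nlinarith
    _ ≤ ack (m + 3) ((w + 1) ^ 2) := ack_add_one_sq_lt_ack_add_three _ _
    _ ≤ ack (m + 3) (ack (m + 3) (2 * v)) :=
        ack_mono_right _ (ack_add_one_sq_lt_ack_add_three _ _)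
    _ ≤ ack (m + 5) (2 * v) := by
        have := ack_ack_lt_ack_max_add_two (m + 3) (m + 3) (2 * v)
        rw [max_self] at this
        exact this.le
    _ ≤ ack (m + 5) (ack 2 v) := ack_mono_right _ (by rw [ack_two]; omega)
    _ ≤ ack (m + 7) v := by
        have := ack_ack_lt_ack_max_add_two (m + 5) 2 v
        rw [max_eq_left (by omega)] at this
        exact this.le

/-- By `ack_step`, one step of the recursion for `j` amounts to at most one step of the second
argument of the Ackermann function, if its first argument exceeds the one used for `k - 1` and for
`i - 1` by `8`. -/
theorem numLive_combSeq_le {R : ℕ} (k i j : ℕ) :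
    (combSeq R k i j).numLive ≤ ack (8 * (k + i)) (j + R) := by
  match k, i, j with
  | 0, i, j =>
    rw [combSeq]
    simpa [twoUp] using Nat.succ_le_of_lt (ack_pos _ _)
  | k + 1, 0, j =>
    rw [combSeq]
    simpa [twoDown] using Nat.succ_le_of_lt (ack_pos _ _)
  | k + 1, i + 1, 0 =>
    rw [combSeq, numLive, List.countP_replicate]
    simpa [Block.isLive] using (lt_ack_right _ _).le
  | k + 1, i + 1, j + 1 =>
    rw [numLive_combSeq_succ]
    have h1 := numLive_combSeq_le (R := R) (k + 1) (i + 1) j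
    set l := (combSeq R (k + 1) (i + 1) j).numLive
    have h2 := numLive_combSeq_le (R := R) k (i + 1) l
    set a := (combSeq R k (i + 1) l).numLive
    have h3 := numLive_combSeq_le (R := R) (k + 1) i (l * a)
    set b := (combSeq R (k + 1) i (l * a)).numLive
    set v := ack (8 * (k + 1 + (i + 1))) (j + R)
    have hv : R ≤ v := by
      have := lt_ack_right (8 * (k + 1 + (i + 1))) (j + R)
      omega
    have e1 : 8 * (k + (i + 1)) = 8 * (k + i + 1) := by ring
    have e2 : 8 * (k + 1 + i) = 8 * (k + i + 1) := by ring
    rw [e1] at h2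
    rw [e2] at h3
    have step := ack_step (m := 8 * (k + i + 1)) (v := v) (R := R) (a := a) (b := b) hv
      (h2.trans (ack_mono_right _ (by omega)))
      (h3.trans (ack_mono_right _ (by
        have := Nat.mul_le_mul_right a h1
        omega)))
    calc b * a * l ≤ b * a * v := Nat.mul_le_mul_left _ h1
      _ ≤ ack (8 * (k + i + 1) + 7) v := step
      _ = ack (8 * (k + 1 + (i + 1))) (j + 1 + R) := by
        rw [show j + 1 + R = (j + R) + 1 by ring,
          show 8 * (k + 1 + (i + 1)) = (8 * (k + i + 1) + 7) + 1 by ring, ack_succ_succ]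
        congr 1
        exact congrArg (ack · (j + R)) (by ring)
termination_by (k, i, j)

/-! ### The lower bound -/

theorem length_mul_le {T : BlockSeq} {R : ℕ} (h : ∀ B ∈ T, R ≤ B.symbols.length) :
    T.length * R ≤ (symbols T).length := by
  induction T with
  | nil => simp
  | cons B T ih =>
    rw [symbols_cons, List.length_append, List.length_cons, Nat.add_mul, Nat.one_mul, Nat.add_comm]
    exact Nat.add_le_add (h B List.mem_cons_self) (ih fun B hB => h B (List.mem_cons_of_mem _ hB))

/-- The construction with parameter `i` is usable as soon as its alphabet fits into `n` symbols. -/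
theorem mul_choose_le_Ex {k i n : ℕ} (hk : 1 ≤ k)
    (hn : ackArray (8 * (k + i) + 5) 3 ≤ n) : n * (i + k).choose k ≤ 4 * Ex (comb k) n := by
  -- With blocks of length at least `R`, at most half of the symbols are lost in becoming sparse.
  set R := 2 * (k + 1) with hRdef
  have hR : 1 ≤ R := by omega
  set T := combSeq R k i R with hT
  have hinv : CombInvariant k R T := combInvariant_combSeq R k i R
  have hlen : T.symbols.length = (1 + (i + k).choose k) * (R * T.numLive) := length_combSeq R k i R
  have halph : alphabetSize T.symbols = R * T.numLive := alphabetSize_combSeq R k i R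
  have hpos : 0 < R * T.numLive := Nat.mul_pos hR (numLive_combSeq_pos hR k i R)
  have hblocks : T.length * R ≤ T.symbols.length := length_mul_le fun B hB => by
    cases B with
    | live M => exact (hinv.basic.live_length M hB).ge
    | dead D => exact dead_length_combSeq hR k i R (.inl le_rfl) hB
  obtain ⟨S, hsub, hsparse, hS⟩ := exists_isSparse_sublist hinv.basic.nodup (k + 2)
  have hmem : S.length ∈ freeLengths (comb k) (alphabetSize S) :=
    ⟨S, rfl, fun h => (hinv.combFree hk).not_contains (h.mono hsub), rfl,
      by rwa [alphabetSize_comb]⟩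
  have hSN : alphabetSize S ≤ R * T.numLive := by
    rw [← halph]
    exact Finset.card_le_card fun x hx =>
      List.mem_toFinset.2 (hsub.subset (List.mem_toFinset.1 hx))
  have hEx := mul_le_Ex (n := n) hmem hSN
  have hNn : R * T.numLive ≤ n := by
    refine le_trans ?_ hn
    refine le_trans ?_ (ack_le_ackArray_three (m := 8 * (k + i) + 3) (n := R + R) ?_)
    · refine le_trans ?_ (ack_add_one_sq_lt_ack_add_three _ _)
      have h1 : T.numLive ≤ ack (8 * (k + i)) (R + R) := numLive_combSeq_le k i R
      have h2 := lt_ack_right (8 * (k + i)) (R + R)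
      nlinarith
    · have : 8 * (k + i) + 3 + 3 < 2 ^ (8 * (k + i) + 3 + 3) := Nat.lt_two_pow_self
      omega
  generalize R * T.numLive = N at *
  generalize (i + k).choose k = c at *
  have h2S : (1 + c) * N ≤ 2 * S.length := by
    have e : T.length * R = 2 * ((k + 1) * T.length) := by rw [hRdef]; ring
    have e' : (k + 2 - 1) * T.length = (k + 1) * T.length := rfl
    rw [e'] at hS
    omega
  have hq : n ≤ 2 * (n / N * N) := by
    have h1 : 1 ≤ n / N := (Nat.one_le_div_iff hpos).2 hNn
    have h2 := Nat.div_add_mod n N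
    have h3 := Nat.mod_lt n hpos
    nlinarith
  calc n * c ≤ 2 * (n / N * N) * c := Nat.mul_le_mul_right _ hq
    _ ≤ 2 * (n / N) * ((1 + c) * N) := by nlinarith [Nat.zero_le (n / N * N)]
    _ ≤ 2 * (n / N) * (2 * S.length) := Nat.mul_le_mul_left _ h2S
    _ = 4 * (n / N * S.length) := by ring
    _ ≤ 4 * Ex (comb k) n := Nat.mul_le_mul_left _ hEx

theorem ackArray_lt_of_lt_alpha {n i : ℕ} (hn : 1 ≤ n) (hi : 1 ≤ i) (h : i < alpha n) :
    ackArray i 3 < n := by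
  by_contra! hle
  have hn' : (n : ℚ) ≠ 0 := by positivity
  have hceil : max ⌈(n : ℚ) / (n : ℚ)⌉₊ 3 = 3 := by
    rw [div_self hn']
    simp
  have : alpha n ≤ i := Nat.sInf_le ⟨hi, by rw [hceil]; exact hle⟩
  omega

theorem pow_le_factorial_mul_choose (i k : ℕ) :
    (i + 1) ^ k ≤ k.factorial * (i + k).choose k := by
  have h := Nat.pow_le_choose (α := ℚ) k (i + k)
  rw [div_le_iff₀ (by positivity), show i + k + 1 - k = i + 1 by omega] at h
  rw [mul_comm]
  exact_mod_cast h

theorem mul_alpha_pow_le_Ex {k n : ℕ} (hk : 1 ≤ k) (hn : 1 ≤ n) :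
    n * alpha n ^ k ≤ (8 * k + 16) ^ k * (k.factorial * 4) * Ex (comb k) n := by
  by_cases hA : alpha n ≤ 8 * k + 5
  · calc n * alpha n ^ k ≤ Ex (comb k) n * (8 * k + 16) ^ k :=
        Nat.mul_le_mul (self_le_Ex k n) (Nat.pow_le_pow_left (by omega) k)
      _ ≤ Ex (comb k) n * ((8 * k + 16) ^ k * (k.factorial * 4)) :=
        Nat.mul_le_mul_left _ (Nat.le_mul_of_pos_right _ (by have := k.factorial_pos; omega))
      _ = _ := by ring
  · -- The largest `i` with `8 * (k + i) + 5 < alpha n`.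
    set i := (alpha n - (8 * k + 6)) / 8 with hi
    have h1 : ackArray (8 * (k + i) + 5) 3 < n :=
      ackArray_lt_of_lt_alpha hn (by omega) (by omega)
    have h2 : alpha n ≤ (8 * k + 16) * (i + 1) := by
      nlinarith [show alpha n ≤ 8 * i + 8 * k + 13 by omega]
    calc n * alpha n ^ k ≤ n * ((8 * k + 16) * (i + 1)) ^ k :=
        Nat.mul_le_mul_left _ (Nat.pow_le_pow_left h2 k)
      _ = n * (8 * k + 16) ^ k * (i + 1) ^ k := by rw [mul_pow]; ring
      _ ≤ n * (8 * k + 16) ^ k * (k.factorial * (i + k).choose k) :=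
        Nat.mul_le_mul_left _ (pow_le_factorial_mul_choose i k)
      _ = (8 * k + 16) ^ k * k.factorial * (n * (i + k).choose k) := by ring
      _ ≤ (8 * k + 16) ^ k * k.factorial * (4 * Ex (comb k) n) :=
        Nat.mul_le_mul_left _ (mul_choose_le_Ex hk h1.le)
      _ = _ := by ring

end GenDS

theorem mainTheorem6 (k : ℕ) (hk : 1 ≤ k) :
    (∀ i j : ℕ, 1 ≤ i →
      ¬ GenDS.Contains (GenDS.classI (GenDS.combPattern k) i j).symbols (GenDS.comb k)) ∧
    (fun n : ℕ => (n : ℝ) * (GenDS.alpha n : ℝ) ^ k)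
      =O[Filter.atTop] (fun n : ℕ => (GenDS.Ex (GenDS.comb k) n : ℝ)) := by
  constructor
  · intro i j hi
    obtain ⟨i, rfl⟩ := Nat.exists_eq_add_of_le' hi
    rw [GenDS.classI_combPattern]
    exact ((GenDS.combInvariant_combSeq 2 k i j).combFree hk).not_contains
  · refine Asymptotics.IsBigO.of_bound (((8 * k + 16) ^ k * (k.factorial * 4) : ℕ) : ℝ) ?_
    filter_upwards [Filter.eventually_ge_atTop 1] with n hn
    rw [Real.norm_of_nonneg (by positivity), Real.norm_of_nonneg (by positivity)]
    exact_mod_cast GenDS.mul_alpha_pow_le_Ex hk hn
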